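/- Let $K$ be a field and let $A$ be a finite-dimensional $K$-algebra; modules are finite-dimensional right $A$-modules unless stated otherwise, and $D=\operatorname{Hom}_K(-,K)$. The dominant dimension $\operatorname{domdim}(M)$ of a (left or right) module $M$ with minimal injective resolution $0\to M\to I_0\to I_1\to\cdots$ is the supremum of all $n\ge 0$ such that $I_0,\dots,I_{n-1}$ are projective; the codominant dimension of a right module $M$ is the dominant dimension of the left module $D(M)$. A module is Gorenstein projective if it is isomorphic to a kernel in an exact complex $(P_n)_{n\in\mathbb Z}$ of finitely generated projective modules that remains exact under $\operatorname{Hom}_A(-,Q)$ for every finitely generated projective module $Q$; it is Gorenstein injective if it is isomorphic to a kernel in an exact complex $(I_n)_{n\in\mathbb Z}$ of finitely generated injective modules that remains exact under $\operatorname{Hom}_A(Q,-)$ for every finitely generated injective module $Q$. The Gorenstein projective dimension of $M$ is the least $n$ for which there is an exact sequence $0\to G_n\to\cdots\to G_0\to M\to 0$ with all $G_i$ Gorenstein projective ($\infty$ if there is none), and the Gorenstein injective dimension of $M$ is the least $n$ for which there is an exact sequence $0\to M\to G_0\to\cdots\to G_n\to 0$ with all $G_i$ Gorenstein injective ($\infty$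 if there is none). Let $r\ge 2$ be an integer and suppose that $A$ is an Auslander–Gorenstein algebra of Gorenstein dimension $r$, that is, the left and the right injective dimension of $A$ are both equal to $r$, and the dominant dimension of the right module $A_A$ is also equal to $r$. Then for every $j=0,1,\dots,r$ and every finite-dimensional right $A$-module $M$: 1. $M$ has dominant dimension at least $r-j$ if and only if $M$ has Gorenstein projective dimension at most $j$; 2. $M$ has codominant dimension at least $r-j$ if and only if $M$ has Gorenstein injective dimension at most $j$. -/

import Mathlib

open scoped MulOpposite

universe u

/-! Modules over a ring `R` are left modules; right modules over `A` are modules over `Aᵐᵒᵖ`. -/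

section Modules

variable (R : Type u) [Ring R]

/-- A submodule `N` of `M` is essential if it meets every nonzero submodule of `M`. -/
def IsEssentialSubmodule {R : Type u} [Ring R] {M : Type u} [AddCommGroup M] [Module R M]
    (N : Submodule R M) : Prop :=
  ∀ L : Submodule R M, L ≠ ⊥ → L ⊓ N ≠ ⊥

/-- A minimal injective resolution `0 → M → I₀ → I₁ → ⋯` of `M`: an exact sequence with all `Iᵢ`
injective, such that the images of `M → I₀` and of `Iᵢ → Iᵢ₊₁` are essential (so that `I₀` is
an injective envelope of `M`, and `Iᵢ₊₁` is one of the cokernel of the preceding map). -/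
structure MinimalInjectiveResolution (M : Type u) [AddCommGroup M] [Module R M] where
  I : ℕ → ModuleCat.{u} R
  ι : M →ₗ[R] I 0
  d : ∀ i : ℕ, I i →ₗ[R] I (i + 1)
  injective : ∀ i, Module.Injective R (I i)
  ι_injective : Function.Injective ι
  exact_zero : Function.Exact ι (d 0)
  exact_succ : ∀ i, Function.Exact (d i) (d (i + 1))
  ι_essential : IsEssentialSubmodule (LinearMap.range ι)
  d_essential : ∀ i, IsEssentialSubmodule (LinearMap.range (d i))

/-- The dominant dimension of `M`: the supremum of all `n` such that the first `n` terms
`I₀, …, Iₙ₋₁` of a minimal injective resolution of `M` are projective. -/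
noncomputable def domDim (M : Type u) [AddCommGroup M] [Module R M] : ℕ∞ :=
  sSup {m : ℕ∞ | ∃ n : ℕ, m = n ∧
    ∃ J : MinimalInjectiveResolution R M, ∀ i < n, Module.Projective R (J.I i)}

/-- `M` is Gorenstein projective: it is (isomorphic to) a kernel in an exact complex
`⋯ → P₋₁ → P₀ → P₁ → ⋯` of finitely generated projective modules that stays exact under
`Hom(-, Q)` for every finitely generated projective `Q`. -/
def IsGorensteinProjective (M : Type u) [AddCommGroup M] [Module R M] : Prop :=
  ∃ (P : ℤ → ModuleCat.{u} R) (d : ∀ n : ℤ, P n →ₗ[R] P (n + 1)),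
    (∀ n, Module.Finite R (P n) ∧ Module.Projective R (P n)) ∧
    (∀ n, Function.Exact (d n) (d (n + 1))) ∧
    (∀ Q : ModuleCat.{u} R, Module.Finite R Q → Module.Projective R Q →
      ∀ (n : ℤ) (f : P (n + 1) →ₗ[R] Q), f ∘ₗ d n = 0 →
        ∃ g : P (n + 1 + 1) →ₗ[R] Q, g ∘ₗ d (n + 1) = f) ∧
    Nonempty (M ≃ₗ[R] LinearMap.ker (d 0))

/-- `M` is Gorenstein injective: it is (isomorphic to) a kernel in an exact complex
`⋯ → I₋₁ → I₀ → I₁ → ⋯` of finitely generated injective modules that stays exact under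
`Hom(Q, -)` for every finitely generated injective `Q`. -/
def IsGorensteinInjective (M : Type u) [AddCommGroup M] [Module R M] : Prop :=
  ∃ (I : ℤ → ModuleCat.{u} R) (d : ∀ n : ℤ, I n →ₗ[R] I (n + 1)),
    (∀ n, Module.Finite R (I n) ∧ Module.Injective R (I n)) ∧
    (∀ n, Function.Exact (d n) (d (n + 1))) ∧
    (∀ Q : ModuleCat.{u} R, Module.Finite R Q → Module.Injective R Q →
      ∀ (n : ℤ) (f : Q →ₗ[R] I (n + 1)), d (n + 1) ∘ₗ f = 0 →
        ∃ g : Q →ₗ[R] I n, d n ∘ₗ g = f) ∧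
    Nonempty (M ≃ₗ[R] LinearMap.ker (d 0))

/-- There is an exact sequence `0 → Gₙ → ⋯ → G₁ → G₀ → M → 0` with all `Gᵢ` Gorenstein
projective (for `n + 1`: a surjection `G₀ → M` whose kernel has such a sequence of length `n`). -/
def HasGorProjResolution : ℕ → ∀ (M : Type u) [AddCommGroup M] [Module R M], Prop
  | 0, M, _, _ => IsGorensteinProjective R M
  | n + 1, M, _, _ => ∃ (G : ModuleCat.{u} R) (p : G →ₗ[R] M),
      IsGorensteinProjective R G ∧ Function.Surjective p ∧
        HasGorProjResolution n (LinearMap.ker p)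

/-- There is an exact sequence `0 → M → G₀ → G₁ → ⋯ → Gₙ → 0` with all `Gᵢ` Gorenstein
injective (for `n + 1`: an injection `M → G₀` whose cokernel has such a sequence of length `n`). -/
def HasGorInjCoresolution : ℕ → ∀ (M : Type u) [AddCommGroup M] [Module R M], Prop
  | 0, M, _, _ => IsGorensteinInjective R M
  | n + 1, M, _, _ => ∃ (G : ModuleCat.{u} R) (ι : M →ₗ[R] G),
      IsGorensteinInjective R G ∧ Function.Injective ι ∧
        HasGorInjCoresolution n (G ⧸ LinearMap.range ι)

/-- The Gorenstein projective dimension: the least length of a Gorenstein projective resolution,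
and `⊤` if there is none. -/
noncomputable def gorProjDim (M : Type u) [AddCommGroup M] [Module R M] : ℕ∞ :=
  sInf {m : ℕ∞ | ∃ n : ℕ, m = n ∧ HasGorProjResolution R n M}

/-- The Gorenstein injective dimension: the least length of a Gorenstein injective coresolution,
and `⊤` if there is none. -/
noncomputable def gorInjDim (M : Type u) [AddCommGroup M] [Module R M] : ℕ∞ :=
  sInf {m : ℕ∞ | ∃ n : ℕ, m = n ∧ HasGorInjCoresolution R n M}

end Modules

section Duality

variable (K A M : Type u) [Field K] [Ring A] [Algebra K A]
  [AddCommGroup M] [Module K M] [Module Aᵐᵒᵖ M] [IsScalarTower K Aᵐᵒᵖ M]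

/-- The dual `D(M) = Hom_K(M, K)` of a right `A`-module `M`, as a left `A`-module with
`(a f)(m) = f (m a)`. -/
def RightDual (K M : Type u) [Field K] [AddCommGroup M] [Module K M] : Type u :=
  M →ₗ[K] K

instance RightDual.instAddCommGroup (K M : Type u) [Field K] [AddCommGroup M] [Module K M] :
    AddCommGroup (RightDual K M) :=
  inferInstanceAs (AddCommGroup (M →ₗ[K] K))

instance RightDual.instModule : Module A (RightDual K M) where
  smul a f := LinearMap.comp (show M →ₗ[K] K from f)
    (Algebra.lsmul K K M (MulOpposite.op a))
  one_smul f := LinearMap.ext fun m => congrArg (show M →ₗ[K] K from f) (one_smul Aᵐᵒᵖ m)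
  mul_smul a b f := LinearMap.ext fun m => congrArg (show M →ₗ[K] K from f)
    (mul_smul (MulOpposite.op b) (MulOpposite.op a) m)
  smul_zero _ := rfl
  smul_add _ _ _ := rfl
  add_smul a b f := LinearMap.ext fun m =>
    (congrArg (show M →ₗ[K] K from f) (add_smul (MulOpposite.op a) (MulOpposite.op b) m)).trans
      (map_add (show M →ₗ[K] K from f) _ _)
  zero_smul f := LinearMap.ext fun m =>
    (congrArg (show M →ₗ[K] K from f) (zero_smul Aᵐᵒᵖ m)).trans
      (map_zero (show M →ₗ[K] K from f))

theorem RightDual.smul_apply (a : A) (f : RightDual K M) (m : M) :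
    (show M →ₗ[K] K from a • f) m = (show M →ₗ[K] K from f) (MulOpposite.op a • m) :=
  rfl

/-- The codominant dimension of a right `A`-module `M`: the dominant dimension of the left
`A`-module `D(M)`. -/
noncomputable def codomDim : ℕ∞ := domDim A (RightDual K M)

end Duality

/-- `A` is Gorenstein of Gorenstein dimension `g`: the injective dimensions of the left and of the
right regular module are both equal to `g`. -/
def IsGorensteinOfDim (A : Type u) [Ring A] (g : ℕ) : Prop :=
  CategoryTheory.injectiveDimension (ModuleCat.of A A) = (g : ℕ∞) ∧
    CategoryTheory.injectiveDimension (ModuleCat.of Aᵐᵒᵖ A) = (g : ℕ∞)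

/-- `A` is Auslander–Gorenstein of Gorenstein dimension `r`: it is Gorenstein of dimension `r`,
the dominant dimension of the right regular module is also `r`, and `r ≥ 2`. -/
def IsAuslanderGorensteinOfDim (A : Type u) [Ring A] (r : ℕ) : Prop :=
  IsGorensteinOfDim A r ∧ domDim Aᵐᵒᵖ A = r ∧ 2 ≤ r

/-!
Right `A`-modules are modules over `R = Aᵐᵒᵖ`. The arguments are set up for two rings `R` and `S`
with a bimodule `U` that is free of rank one over each of them (`IsRegularGenerator`; here `U = A`,
`S = A`) and a bimodule `E` inducing a Morita duality (`IsHalfDuality`; here `E = Hom_K(A, K)`), so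
that left and right modules play symmetric roles.

*Dominant dimension.* For finitely generated `M`, `n ≤ domdim M` holds if and only if
`Ext^i(T, M) = 0` for all `i < n` and all `T` without nonzero maps to projective-injective modules
(`le_domDim_iff`). In this form the behaviour of the dominant dimension in short exact sequences is
the long exact sequence of `Ext`.

*Gorenstein projective dimension at most `j` implies dominant dimension at least `r - j`.* A
Gorenstein projective module is a syzygy of arbitrarily high order of modules of the same kind, with
projective middle terms of dominant dimension at least `r`; hence it has dominant dimension at least
`r`, and one argues along a resolution (`HasGorProjResolution.domDimGE`).

*Dominant dimension at least `r - j` implies Gorenstein projective dimension at most `j`.* A module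
`M` of dominant dimension at least `r - j` is an `(r - j)`-th syzygy. As `U` has injective dimension
at most `r`, it follows that `Ext^i(M, U) = 0` for `i > j` (`DomDimGE.gorDimLE`), so the `j`-th
syzygies `X` of `M` satisfy `Ext^i(X, U) = 0` for all `i ≥ 1`. Such an `X` is Gorenstein projective
(`GorDimLE.isGorensteinProjective`): the dual of a free resolution shows that `Hom(X, U)` is an
arbitrarily high syzygy, so the finite injective dimension of `U` on the other side makes `X`
torsionless; then the embedding of `X` into the dual of a free cover of `Hom(X, U)` has a cokernel
in the same class, and such embeddings can be iterated.

*Codominant dimension.* The duality `Hom(-, E)` translates the second part into the first one for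
`S`-modules. This needs that the dominant dimension of `U` over `S` is also at least `r`, the
left-right symmetry of the dominant dimension (`IsRegularGenerator.domDimGE_symm`).
-/

/-! ### Short exact sequences and vanishing of `Ext` -/

section ExtVanishing

open CategoryTheory

/-- `0 → X → Y → Z → 0` is a short exact sequence of `R`-modules. -/
structure IsSES {R : Type u} [Ring R] {X Y Z : Type u} [AddCommGroup X] [AddCommGroup Y]
    [AddCommGroup Z] [Module R X] [Module R Y] [Module R Z]
    (f : X →ₗ[R] Y) (g : Y →ₗ[R] Z) : Prop where
  inj : Function.Injective f
  exact : Function.Exact f g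
  surj : Function.Surjective g

/-- `Ext^i_R(X, Y) = 0`. -/
def ExtVanish (R : Type u) [Ring R] (X Y : Type u) [AddCommGroup X] [AddCommGroup Y]
    [Module R X] [Module R Y] (i : ℕ) : Prop :=
  Subsingleton (Abelian.Ext (ModuleCat.of R X) (ModuleCat.of R Y) i)

variable {R : Type u} [Ring R] {X Y Z : Type u} [AddCommGroup X] [AddCommGroup Y]
    [AddCommGroup Z] [Module R X] [Module R Y] [Module R Z]
    {T N : Type u} [AddCommGroup T] [Module R T] [AddCommGroup N] [Module R N]

namespace IsSES

variable {f : X →ₗ[R] Y} {g : Y →ₗ[R] Z}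

theorem mkQ {f : X →ₗ[R] Y} (hf : Function.Injective f) :
    IsSES f (LinearMap.range f).mkQ :=
  ⟨hf, LinearMap.exact_map_mkQ_range f, Submodule.mkQ_surjective _⟩

theorem ker_subtype {g : Y →ₗ[R] Z} (hg : Function.Surjective g) :
    IsSES (LinearMap.ker g).subtype g :=
  ⟨Submodule.injective_subtype _, LinearMap.exact_subtype_ker_map g, hg⟩

theorem comp_eq_zero (h : IsSES f g) : g ∘ₗ f = 0 := h.exact.linearMap_comp_eq_zero

/-- The short complex in `ModuleCat R` given by a short exact sequence. -/
abbrev shortComplex (h : IsSES f g) : ShortComplex (ModuleCat.{u} R) :=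
  ModuleCat.shortComplexOfCompEqZero f g h.comp_eq_zero

theorem shortExact (h : IsSES f g) : h.shortComplex.ShortExact :=
  ModuleCat.shortComplex_shortExact _ h.exact h.inj h.surj

/-- A map on the middle term that kills the submodule descends to the quotient. -/
theorem exists_desc (h : IsSES f g) (φ : Y →ₗ[R] N) (hφ : φ ∘ₗ f = 0) :
    ∃ ψ : Z →ₗ[R] N, ψ ∘ₗ g = φ := by
  have hk : LinearMap.ker g ≤ LinearMap.ker φ := by
    intro y hy
    obtain ⟨x, rfl⟩ := (h.exact y).1 hy
    exact LinearMap.congr_fun hφ x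
  let e := g.quotKerEquivOfSurjective h.surj
  refine ⟨((LinearMap.ker g).liftQ φ hk) ∘ₗ e.symm.toLinearMap, ?_⟩
  ext y
  have : e.symm (g y) = (LinearMap.ker g).mkQ y := by
    rw [LinearEquiv.symm_apply_eq]; rfl
  simp [this]

/-- A map into the middle term that dies in the quotient factors through the submodule. -/
theorem exists_lift (h : IsSES f g) (φ : T →ₗ[R] Y) (hφ : g ∘ₗ φ = 0) :
    ∃ ψ : T →ₗ[R] X, f ∘ₗ ψ = φ := by
  have hr : ∀ t, φ t ∈ LinearMap.range f := fun t =>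
    (h.exact _).1 (LinearMap.congr_fun hφ t)
  let e := LinearEquiv.ofInjective f h.inj
  refine ⟨e.symm.toLinearMap ∘ₗ φ.codRestrict _ hr, ?_⟩
  ext t
  have := e.apply_symm_apply (φ.codRestrict _ hr t)
  exact congrArg Subtype.val this

end IsSES

namespace ExtVanish

variable {f : X →ₗ[R] Y} {g : Y →ₗ[R] Z} {i : ℕ}

theorem right (h : IsSES f g) (h₂ : ExtVanish R T Y i) (h₁ : ExtVanish R T X (i + 1)) :
    ExtVanish R T Z i := by
  refine subsingleton_of_forall_eq 0 fun x => ?_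
  obtain ⟨y, rfl⟩ := Abelian.Ext.covariant_sequence_exact₃ _ h.shortExact x rfl
    (@Subsingleton.elim _ h₁ _ _)
  rw [@Subsingleton.elim _ h₂ y 0, Abelian.Ext.zero_comp]

theorem left (h : IsSES f g) (h₃ : ExtVanish R T Z i) (h₂ : ExtVanish R T Y (i + 1)) :
    ExtVanish R T X (i + 1) := by
  refine subsingleton_of_forall_eq 0 fun x => ?_
  obtain ⟨y, rfl⟩ := Abelian.Ext.covariant_sequence_exact₁ _ h.shortExact x
    (@Subsingleton.elim _ h₂ _ _) rfl
  rw [@Subsingleton.elim _ h₃ y 0, Abelian.Ext.zero_comp]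

theorem contra_left (h : IsSES f g) (h₂ : ExtVanish R Y N i) (h₃ : ExtVanish R Z N (i + 1)) :
    ExtVanish R X N i := by
  refine subsingleton_of_forall_eq 0 fun x => ?_
  obtain ⟨y, rfl⟩ := Abelian.Ext.contravariant_sequence_exact₁ h.shortExact _ x (add_comm 1 i)
    (@Subsingleton.elim _ h₃ _ _)
  rw [@Subsingleton.elim _ h₂ y 0, Abelian.Ext.comp_zero]

theorem contra_right (h : IsSES f g) (h₁ : ExtVanish R X N i) (h₂ : ExtVanish R Y N (i + 1)) :
    ExtVanish R Z N (i + 1) := by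
  refine subsingleton_of_forall_eq 0 fun x => ?_
  obtain ⟨y, rfl⟩ := Abelian.Ext.contravariant_sequence_exact₃ h.shortExact _ x
    (@Subsingleton.elim _ h₂ _ _) (add_comm 1 i)
  rw [@Subsingleton.elim _ h₁ y 0, Abelian.Ext.comp_zero]

theorem of_projective [Module.Projective R X] : ExtVanish R X N (i + 1) :=
  have : Projective (ModuleCat.of R X) := (IsProjective.iff_projective X).1 inferInstance
  Abelian.Ext.subsingleton_of_projective _ _ _

theorem of_injective [Module.Injective R N] : ExtVanish R X N (i + 1) :=
  have : Injective (ModuleCat.of R N) := Module.injective_object_of_injective_module R N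
  Abelian.Ext.subsingleton_of_injective _ _ _

theorem zero_iff : ExtVanish R X N 0 ↔ ∀ φ : X →ₗ[R] N, φ = 0 := by
  unfold ExtVanish
  rw [Abelian.Ext.homEquiv₀.subsingleton_congr]
  constructor
  · intro h φ
    exact congrArg ModuleCat.Hom.hom (Subsingleton.elim (ModuleCat.ofHom φ) 0)
  · intro h
    refine subsingleton_of_forall_eq 0 fun φ => ?_
    ext1
    exact h φ.hom

/-- If `Ext¹(Z, N) = 0`, maps to `N` extend along `X → Y`. -/
theorem exists_extend (h : IsSES f g) (h₃ : ExtVanish R Z N 1) (φ : X →ₗ[R] N) :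
    ∃ ψ : Y →ₗ[R] N, ψ ∘ₗ f = φ := by
  obtain ⟨y, hy⟩ := Abelian.Ext.contravariant_sequence_exact₁ h.shortExact _
    (Abelian.Ext.mk₀ (ModuleCat.ofHom φ)) (add_zero 1) (@Subsingleton.elim _ h₃ _ _)
  obtain ⟨ψ, rfl⟩ := (Abelian.Ext.mk₀_bijective _ _).2 y
  rw [Abelian.Ext.mk₀_comp_mk₀] at hy
  exact ⟨ψ.hom, congrArg ModuleCat.Hom.hom ((Abelian.Ext.mk₀_bijective _ _).1 hy)⟩

/-- If `Y` is projective and all maps `X → N` extend to `Y`, then `Ext¹(Z, N) = 0`. -/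
theorem one_of_extend (h : IsSES f g) [Module.Projective R Y]
    (H : ∀ φ : X →ₗ[R] N, ∃ ψ : Y →ₗ[R] N, ψ ∘ₗ f = φ) : ExtVanish R Z N 1 := by
  refine subsingleton_of_forall_eq 0 fun x => ?_
  obtain ⟨y, rfl⟩ := Abelian.Ext.contravariant_sequence_exact₃ h.shortExact _ x
    (@Subsingleton.elim _ (of_projective (R := R) (X := Y) (N := N) (i := 0)) _ _) (add_zero 1)
  obtain ⟨φ, rfl⟩ := (Abelian.Ext.mk₀_bijective _ _).2 y
  obtain ⟨ψ, hψ⟩ := H φ.hom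
  have : φ = h.shortComplex.f ≫ ModuleCat.ofHom ψ := by
    ext1; exact hψ.symm
  rw [this, ← Abelian.Ext.mk₀_comp_mk₀]
  exact h.shortExact.extClass_comp_assoc _

theorem congr_left (e : X ≃ₗ[R] Y) (h : ExtVanish R X N i) : ExtVanish R Y N i := by
  have : Subsingleton (Abelian.Ext (ModuleCat.of R X) (ModuleCat.of R N) i) := h
  refine subsingleton_of_forall_eq 0 fun x => ?_
  have h1 : x = (Abelian.Ext.mk₀ e.toModuleIso.inv).comp
      ((Abelian.Ext.mk₀ e.toModuleIso.hom).comp x (zero_add i)) (zero_add i) := by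
    rw [Abelian.Ext.mk₀_comp_mk₀_assoc, Iso.inv_hom_id, Abelian.Ext.mk₀_id_comp]
  rw [h1, Subsingleton.elim ((Abelian.Ext.mk₀ e.toModuleIso.hom).comp x (zero_add i)) 0,
    Abelian.Ext.comp_zero]

/-- `Ext^i(T, X) = 0` passes from `X` to direct summands. -/
theorem of_retract (s : Y →ₗ[R] X) (p : X →ₗ[R] Y) (hps : p ∘ₗ s = LinearMap.id)
    (h : ExtVanish R T X i) : ExtVanish R T Y i := by
  have : Subsingleton (Abelian.Ext (ModuleCat.of R T) (ModuleCat.of R X) i) := h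
  refine subsingleton_of_forall_eq 0 fun x => ?_
  have h1 : x = (x.comp (Abelian.Ext.mk₀ (ModuleCat.ofHom s)) (add_zero i)).comp
      (Abelian.Ext.mk₀ (ModuleCat.ofHom p)) (add_zero i) := by
    rw [Abelian.Ext.comp_assoc_of_second_deg_zero, Abelian.Ext.mk₀_comp_mk₀,
      ← ModuleCat.ofHom_comp, hps]
    exact (Abelian.Ext.comp_mk₀_id x).symm
  rw [h1, Subsingleton.elim (x.comp (Abelian.Ext.mk₀ (ModuleCat.ofHom s)) (add_zero i)) 0,
    Abelian.Ext.zero_comp]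

/-- `Ext^i(T, -)` vanishes on finite powers of a module on which it vanishes. -/
theorem pi (h : ExtVanish R T X i) (n : ℕ) : ExtVanish R T (Fin n → X) i := by
  have : Subsingleton (Abelian.Ext (ModuleCat.of R T) (ModuleCat.of R X) i) := h
  refine subsingleton_of_forall_eq 0 fun x => ?_
  have h1 : ModuleCat.ofHom (LinearMap.id : (Fin n → X) →ₗ[R] _) =
      ∑ k : Fin n, ModuleCat.ofHom (LinearMap.proj (R := R) (φ := fun _ : Fin n => X) k) ≫
        ModuleCat.ofHom (LinearMap.single R (fun _ : Fin n => X) k) := by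
    ext1
    rw [ModuleCat.hom_sum]
    simp only [← ModuleCat.ofHom_comp, ModuleCat.hom_ofHom]
    ext v k
    simp [Finset.sum_apply, Pi.single_apply]
  have h2 : x = x.comp (Abelian.Ext.mk₀ (ModuleCat.ofHom LinearMap.id)) (add_zero i) :=
    (Abelian.Ext.comp_mk₀_id x).symm
  rw [h2, h1, Abelian.Ext.mk₀_sum, Abelian.Ext.comp_sum]
  refine Finset.sum_eq_zero fun k _ => ?_
  rw [← Abelian.Ext.mk₀_comp_mk₀, ← Abelian.Ext.comp_assoc_of_second_deg_zero,
    Subsingleton.elim (x.comp (Abelian.Ext.mk₀ _) (add_zero i)) 0, Abelian.Ext.zero_comp]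

theorem of_injectiveDimension_eq {r : ℕ}
    (h : injectiveDimension (ModuleCat.of R N) = (r : ℕ∞)) (hi : r < i) : ExtVanish R X N i := by
  have : HasInjectiveDimensionLE (ModuleCat.of R N) r :=
    (injectiveDimension_le_iff _ _).1 (by rw [h]; rfl)
  exact HasInjectiveDimensionLT.subsingleton _ (r + 1) i hi _

end ExtVanish

end ExtVanishing

/-! ### Dominant dimension and vanishing of `Ext` -/

section DominantDimension

/-- A finitely generated module without nonzero maps to finitely generated projective-injective
modules. -/
def IsDomTorsion (R : Type u) [Ring R] (T : Type u) [AddCommGroup T] [Module R T] : Prop :=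
  Module.Finite R T ∧ ∀ Y : ModuleCat.{u} R, Module.Finite R Y → Module.Projective R Y →
    Module.Injective R Y → ∀ φ : T →ₗ[R] Y, φ = 0

/-- The homological form of `n ≤ domdim M`, for finitely generated `M` over an Artin algebra: the
groups `Ext^i(T, M)` vanish for all `i < n` and all finitely generated modules `T` without nonzero
maps to projective-injective modules. -/
def DomDimGE (R : Type u) [Ring R] (n : ℕ) (M : Type u) [AddCommGroup M] [Module R M] : Prop :=
  ∀ T : ModuleCat.{u} R, IsDomTorsion R T → ∀ i < n, ExtVanish R T M i

variable {R : Type u} [Ring R] {X Y Z : Type u} [AddCommGroup X] [AddCommGroup Y]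
    [AddCommGroup Z] [Module R X] [Module R Y] [Module R Z]
    {M : Type u} [AddCommGroup M] [Module R M]

namespace DomDimGE

variable {f : X →ₗ[R] Y} {g : Y →ₗ[R] Z} {n m : ℕ}

theorem mono (h : DomDimGE R n M) (hm : m ≤ n) : DomDimGE R m M :=
  fun T hT i hi => h T hT i (hi.trans_le hm)

theorem zero : DomDimGE R 0 M := fun _ _ _ hi => absurd hi (Nat.not_lt_zero _)

theorem right (h : IsSES f g) (hX : DomDimGE R (n + 1) X) (hY : DomDimGE R n Y) :
    DomDimGE R n Z :=
  fun T hT i hi => (hY T hT i hi).right h (hX T hT (i + 1) (by lia))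

theorem left (h : IsSES f g) (hY : DomDimGE R (n + 1) Y) (hZ : DomDimGE R n Z) :
    DomDimGE R (n + 1) X := by
  intro T hT i hi
  cases i with
  | zero =>
    rw [ExtVanish.zero_iff]
    intro φ
    have := ExtVanish.zero_iff.1 (hY T hT 0 hi) (f ∘ₗ φ)
    ext t
    exact h.inj (by simpa using LinearMap.congr_fun this t)
  | succ i => exact (hZ T hT i (by lia)).left h (hY T hT (i + 1) hi)

theorem of_projective_injective [Module.Finite R X] [Module.Projective R X]
    [hX : Module.Injective R X] : DomDimGE R n X := by
  intro T hT i _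
  cases i with
  | zero => exact ExtVanish.zero_iff.2 (hT.2 (ModuleCat.of R X) ‹_› ‹_› hX)
  | succ i => exact ExtVanish.of_injective

theorem of_retract (s : Y →ₗ[R] X) (p : X →ₗ[R] Y) (hps : p ∘ₗ s = LinearMap.id)
    (h : DomDimGE R n X) : DomDimGE R n Y :=
  fun T hT i hi => (h T hT i hi).of_retract s p hps

theorem congr (e : X ≃ₗ[R] Y) (h : DomDimGE R n X) : DomDimGE R n Y :=
  h.of_retract e.symm.toLinearMap e.toLinearMap (LinearMap.ext e.apply_symm_apply)

theorem pi (h : DomDimGE R n X) (k : ℕ) : DomDimGE R n (Fin k → X) :=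
  fun T hT i hi => (h T hT i hi).pi k

end DomDimGE

theorem Module.Injective.prod [Module.Injective R X] [Module.Injective R Y] :
    Module.Injective R (X × Y) where
  out A B _ _ _ _ i hi φ := by
    obtain ⟨a, ha⟩ := Module.Injective.out (Q := X) i hi (LinearMap.fst R X Y ∘ₗ φ)
    obtain ⟨b, hb⟩ := Module.Injective.out (Q := Y) i hi (LinearMap.snd R X Y ∘ₗ φ)
    exact ⟨a.prod b, fun x => Prod.ext (ha x) (hb x)⟩

theorem Module.Injective.of_retract [Module.Injective R X] (s : Y →ₗ[R] X) (p : X →ₗ[R] Y)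
    (hps : p ∘ₗ s = LinearMap.id) : Module.Injective R Y where
  out A B _ _ _ _ i hi φ := by
    obtain ⟨a, ha⟩ := Module.Injective.out (Q := X) i hi (s ∘ₗ φ)
    exact ⟨p ∘ₗ a, fun x => by simpa [ha] using LinearMap.congr_fun hps (φ x)⟩

/-- Among the kernels of maps from `M` to projective-injective modules there is a smallest one;
it has no nonzero maps to projective-injective modules, hence vanishes. -/
theorem DomDimGE.exists_embedding [IsArtinianRing R] [Module.Finite R M] (h : DomDimGE R 1 M) :
    ∃ (X : ModuleCat.{u} R) (φ : M →ₗ[R] X), Module.Finite R X ∧ Module.Projective R X ∧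
      Module.Injective R X ∧ Function.Injective φ := by
  let S : Set (Submodule R M) := {N | ∃ (X : ModuleCat.{u} R) (φ : M →ₗ[R] X),
    Module.Finite R X ∧ Module.Projective R X ∧ Module.Injective R X ∧ LinearMap.ker φ = N}
  have hS : S.Nonempty := by
    refine ⟨⊤, ModuleCat.of R PUnit, 0, inferInstance, inferInstance, ⟨?_⟩, by simp⟩
    intro A B _ _ _ _ i _ φ
    exact ⟨0, fun x => Subsingleton.elim _ _⟩
  obtain ⟨N, ⟨X, φ, h1, h2, h3, rfl⟩, hmin⟩ := WellFounded.has_min (wellFounded_lt) S hS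
  refine ⟨X, φ, h1, h2, h3, ?_⟩
  have htors : IsDomTorsion R (LinearMap.ker φ) := by
    refine ⟨inferInstance, fun Y g1 g2 g3 ψ => ?_⟩
    obtain ⟨ψ', hψ'⟩ := Module.Injective.out (LinearMap.ker φ).subtype
      (Submodule.injective_subtype _) ψ
    have hmem : LinearMap.ker (φ.prod ψ') ∈ S :=
      ⟨ModuleCat.of R (X × Y), φ.prod ψ', inferInstanceAs (Module.Finite R (X × Y)),
        inferInstanceAs (Module.Projective R (X × Y)), Module.Injective.prod, rfl⟩
    have hle : LinearMap.ker (φ.prod ψ') ≤ LinearMap.ker φ := by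
      rw [LinearMap.ker_prod]; exact inf_le_left
    have heq := eq_of_le_of_not_lt hle (hmin _ hmem)
    ext t
    have ht : (t : M) ∈ LinearMap.ker (φ.prod ψ') := by rw [heq]; exact t.2
    rw [LinearMap.ker_prod] at ht
    rw [← hψ']
    exact ht.2
  have h0 := ExtVanish.zero_iff.1 (h (ModuleCat.of R (LinearMap.ker φ)) htors 0 one_pos)
    (LinearMap.ker φ).subtype
  rw [← LinearMap.ker_eq_bot, Submodule.eq_bot_iff]
  intro x hx
  exact LinearMap.congr_fun h0 ⟨x, hx⟩

/-- A projective module that is an essential extension of a finitely generated module is finitely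
generated: the finitely many coordinates of the submodule already detect all elements. -/
theorem Module.Finite.of_projective_of_essential [IsNoetherianRing R] [Module.Finite R X]
    [Module.Projective R Y] (ι : X →ₗ[R] Y) (hι : IsEssentialSubmodule (LinearMap.range ι)) :
    Module.Finite R Y := by
  classical
  obtain ⟨s, hs⟩ := Module.projective_def'.1 (inferInstance : Module.Projective R Y)
  have hsinj : Function.Injective s := fun a b hab => by
    simpa [hab] using ((LinearMap.congr_fun hs a).symm.trans
      (by simp [hab])).trans (LinearMap.congr_fun hs b)
  obtain ⟨G, hG⟩ := (inferInstance : Module.Finite R X)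
  let F : Finset Y := G.biUnion fun x => (s (ι x)).support
  have hF : ∀ x : X, s (ι x) ∈ Finsupp.supported R R (F : Set Y) := by
    have : (⊤ : Submodule R X) ≤ (Finsupp.supported R R (F : Set Y)).comap (s ∘ₗ ι) := by
      rw [← hG, Submodule.span_le]
      intro x hx
      rw [SetLike.mem_coe, Submodule.mem_comap, Finsupp.mem_supported]
      intro y hy
      exact Finset.mem_biUnion.2 ⟨x, hx, hy⟩
    exact fun x => this trivial
  let q : (Y →₀ R) →ₗ[R] (F → R) := LinearMap.pi fun y => Finsupp.lapply (y : Y)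
  have hker : LinearMap.ker (q ∘ₗ s) = ⊥ := by
    by_contra hne
    refine hι _ hne ?_
    rw [Submodule.eq_bot_iff]
    rintro _ ⟨hy, x, rfl⟩
    apply hsinj
    rw [map_zero]
    ext y
    by_cases hyF : y ∈ F
    · exact congrFun (hy : q (s (ι x)) = 0) ⟨y, hyF⟩
    · exact Finsupp.notMem_support_iff.1 fun h => hyF (hF x h)
  exact Module.Finite.of_injective (q ∘ₗ s) (LinearMap.ker_eq_bot.1 hker)

/-- The minimal injective resolution of the first cosyzygy. -/
def MinimalInjectiveResolution.shift (J : MinimalInjectiveResolution R M) :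
    MinimalInjectiveResolution R (LinearMap.range (J.d 0)) where
  I i := J.I (i + 1)
  ι := (LinearMap.range (J.d 0)).subtype
  d i := J.d (i + 1)
  injective i := J.injective (i + 1)
  ι_injective := Submodule.injective_subtype _
  exact_zero y := by
    rw [J.exact_succ 0 y]
    simp
  exact_succ i := J.exact_succ (i + 1)
  ι_essential := by
    rw [Submodule.range_subtype]
    exact J.d_essential 0
  d_essential i := J.d_essential (i + 1)

/-- By induction the first `n` cosyzygies are finitely generated, and hence so are their projective
envelopes; these terms contribute nothing to `Ext^i(T, M)` for `i < n`. -/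
theorem MinimalInjectiveResolution.domDimGE [IsNoetherianRing R] {n : ℕ} :
    ∀ {M : Type u} [AddCommGroup M] [Module R M] [Module.Finite R M]
      (J : MinimalInjectiveResolution R M), (∀ i < n, Module.Projective R (J.I i)) →
      DomDimGE R n M := by
  induction n with
  | zero => intro M _ _ _ J _; exact DomDimGE.zero
  | succ n ih =>
    intro M _ _ _ J hJ
    have h0 : Module.Projective R (J.I 0) := hJ 0 (Nat.succ_pos n)
    have hfin : Module.Finite R (J.I 0) := Module.Finite.of_projective_of_essential _ J.ι_essential
    have hinj := J.injective 0
    have hses : IsSES J.ι (J.d 0).rangeRestrict :=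
      ⟨J.ι_injective, fun y => by rw [← J.exact_zero y]; simp [Subtype.ext_iff],
        LinearMap.surjective_rangeRestrict _⟩
    exact DomDimGE.left hses DomDimGE.of_projective_injective
      (ih J.shift fun i hi => hJ (i + 1) (by lia))

theorem DomDimGE.of_le_domDim [IsNoetherianRing R] [Module.Finite R M] {n : ℕ}
    (h : (n : ℕ∞) ≤ domDim R M) : DomDimGE R n M := by
  cases n with
  | zero => exact DomDimGE.zero
  | succ n =>
    have h' : (n : ℕ∞) < domDim R M := lt_of_lt_of_le (by exact_mod_cast Nat.lt_succ_self n) h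
    obtain ⟨_, ⟨m, rfl, J, hJ⟩, hm⟩ := lt_sSup_iff.1 h'
    exact (J.domDimGE hJ).mono (by exact_mod_cast hm)

/-- A maximal essential extension of `X` inside an injective module `Q` is a direct summand of
`Q`, hence an injective envelope of `X`. -/
theorem exists_injective_envelope [IsNoetherianRing R] [Module.Finite R Y]
    [Module.Injective R Y] (j : X →ₗ[R] Y) (hj : Function.Injective j) :
    ∃ (I : ModuleCat.{u} R) (ι : X →ₗ[R] I), Module.Finite R I ∧ Module.Injective R I ∧
      Function.Injective ι ∧ IsEssentialSubmodule (LinearMap.range ι) := by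
  let N := LinearMap.range j
  let S : Set (Submodule R Y) := {E | N ≤ E ∧ ∀ L ≤ E, L ≠ ⊥ → L ⊓ N ≠ ⊥}
  obtain ⟨E, ⟨hNE, hE⟩, hEmax⟩ := WellFounded.has_min (wellFounded_gt (α := Submodule R Y)) S
    ⟨N, le_rfl, fun L hL h0 => by rwa [inf_eq_left.2 hL]⟩
  let S' : Set (Submodule R Y) := {C | C ⊓ E = ⊥}
  obtain ⟨C, hC, hCmax⟩ := WellFounded.has_min (wellFounded_gt (α := Submodule R Y)) S'
    ⟨⊥, bot_inf_eq _⟩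
  have hC : C ⊓ E = ⊥ := hC
  -- `E` embeds in `Y / C` as an essential submodule.
  let a : E →ₗ[R] Y ⧸ C := C.mkQ ∘ₗ E.subtype
  have ha : Function.Injective a := by
    rw [← LinearMap.ker_eq_bot, Submodule.eq_bot_iff]
    intro x hx
    have : (x : Y) ∈ C ⊓ E := ⟨(Submodule.Quotient.mk_eq_zero C).1 hx, x.2⟩
    rw [hC] at this
    exact Subtype.ext this
  have haess : ∀ D : Submodule R (Y ⧸ C), D ≠ ⊥ → ∃ e : E, a e ∈ D ∧ e ≠ 0 := by
    intro D hD
    have hlt : C < D.comap C.mkQ := by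
      refine lt_of_le_of_ne (fun x hx => ?_) fun heq => hD ?_
      · have : C.mkQ x = 0 := (Submodule.Quotient.mk_eq_zero C).2 hx
        rw [Submodule.mem_comap, this]; exact D.zero_mem
      · rw [Submodule.eq_bot_iff]
        intro z hz
        obtain ⟨y, rfl⟩ := C.mkQ_surjective z
        have hy : y ∈ C := by rw [heq]; exact hz
        exact (Submodule.Quotient.mk_eq_zero C).2 hy
    have hne : D.comap C.mkQ ⊓ E ≠ ⊥ := fun h0 => hCmax _ h0 hlt
    obtain ⟨y, ⟨hyD, hyE⟩, hy0⟩ := Submodule.exists_mem_ne_zero_of_ne_bot hne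
    exact ⟨⟨y, hyE⟩, hyD, fun h => hy0 (congrArg Subtype.val h)⟩
  obtain ⟨b, hb⟩ := Module.Injective.out a ha E.subtype
  have hbinj : LinearMap.ker b = ⊥ := by
    by_contra hne
    obtain ⟨e, he, he0⟩ := haess _ hne
    exact he0 (Subtype.ext ((hb e).symm.trans he))
  -- The image of `Y / C` in `Y` is an essential extension of `X` containing `E`.
  have hrange : E = LinearMap.range b := by
    have hle : E ≤ LinearMap.range b := fun x hx => ⟨a ⟨x, hx⟩, hb ⟨x, hx⟩⟩
    refine eq_of_le_of_not_lt hle (hEmax _ ⟨hNE.trans hle, fun L hL hL0 => ?_⟩)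
    obtain ⟨y, hy, hy0⟩ := Submodule.exists_mem_ne_zero_of_ne_bot hL0
    obtain ⟨z, rfl⟩ := hL hy
    have hne : L.comap b ≠ ⊥ := by
      intro h0
      have : z ∈ L.comap b := hy
      rw [h0, Submodule.mem_bot] at this
      exact hy0 (by rw [this, map_zero])
    obtain ⟨e, he, he0⟩ := haess _ hne
    have he' : (e : Y) ∈ L := by
      have h := hb e
      rw [Submodule.subtype_apply] at h
      rw [← h]; exact he
    have hLE : L ⊓ E ≠ ⊥ := by
      intro h0
      have : (e : Y) ∈ L ⊓ E := ⟨he', e.2⟩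
      rw [h0] at this
      exact he0 (Subtype.ext this)
    intro h0
    refine hE (L ⊓ E) inf_le_right hLE ?_
    rw [inf_assoc, inf_eq_right.2 hNE, h0]
  let b' : (Y ⧸ C) →ₗ[R] E := b.codRestrict E fun z => hrange ▸ LinearMap.mem_range_self b z
  have hEinj : Module.Injective R E :=
    Module.Injective.of_retract E.subtype (b' ∘ₗ C.mkQ)
      (LinearMap.ext fun e => Subtype.ext (hb e))
  refine ⟨ModuleCat.of R E, j.codRestrict E fun x => hNE (LinearMap.mem_range_self j x),
    inferInstanceAs (Module.Finite R E), hEinj, fun x y hxy => hj (congrArg Subtype.val hxy), ?_⟩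
  intro L hL
  have hL' : L.map E.subtype ≠ ⊥ := fun h0 =>
    hL (Submodule.map_injective_of_injective (Submodule.injective_subtype E)
      (h0.trans (Submodule.map_bot _).symm))
  have := hE _ (Submodule.map_subtype_le E L) hL'
  obtain ⟨_, ⟨⟨y, hy, rfl⟩, x, hx⟩, hy0⟩ := Submodule.exists_mem_ne_zero_of_ne_bot this
  refine Submodule.ne_bot_iff _ |>.2 ⟨y, ⟨hy, x, Subtype.ext hx⟩, fun h => hy0 ?_⟩
  rw [h, map_zero]

/-- Every finitely generated module embeds into a finitely generated injective module. -/
def HasFiniteInjectiveEmbeddings (R : Type u) [Ring R] : Prop :=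
  ∀ N : ModuleCat.{u} R, Module.Finite R N → ∃ (I : ModuleCat.{u} R) (ι : N →ₗ[R] I),
    Module.Finite R I ∧ Module.Injective R I ∧ Function.Injective ι

/-- An essential extension by an injective module is a summand of any injective module in which
the base embeds; so an injective envelope of a module of positive dominant dimension is
projective. -/
theorem DomDimGE.projective_of_essential [IsArtinianRing R] [Module.Finite R X]
    (h : DomDimGE R 1 X) [Module.Injective R Y] (ι : X →ₗ[R] Y) (hι : Function.Injective ι)
    (hess : IsEssentialSubmodule (LinearMap.range ι)) : Module.Projective R Y := by
  obtain ⟨Q, φ, hfin, hproj, hinj, hφ⟩ := h.exists_embedding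
  obtain ⟨s, hs⟩ := Module.Injective.out ι hι φ
  have hs0 : LinearMap.ker s = ⊥ := by
    by_contra hne
    refine hess _ hne ?_
    rw [Submodule.eq_bot_iff]
    rintro _ ⟨hy, x, rfl⟩
    have : φ x = 0 := (hs x).symm.trans hy
    rw [hφ (this.trans (map_zero φ).symm), map_zero]
  obtain ⟨p, hp⟩ := Module.Injective.out s (LinearMap.ker_eq_bot.1 hs0) LinearMap.id
  exact Module.Projective.of_split s p (LinearMap.ext hp)

/-- A minimal injective resolution is built by iterating injective envelopes; its `k`-th cosyzygy
keeps dominant dimension at least `n - k`. -/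
theorem DomDimGE.exists_resolution [IsArtinianRing R] (H : HasFiniteInjectiveEmbeddings R)
    [hM : Module.Finite R M] {n : ℕ} (h : DomDimGE R n M) :
    ∃ J : MinimalInjectiveResolution R M, ∀ i < n, Module.Projective R (J.I i) := by
  let St := {N : ModuleCat.{u} R // Module.Finite R N}
  have hull : ∀ N : St, ∃ (I : ModuleCat.{u} R) (ι : N.1 →ₗ[R] I), Module.Finite R I ∧
      Module.Injective R I ∧ Function.Injective ι ∧ IsEssentialSubmodule (LinearMap.range ι) := by
    intro N
    obtain ⟨Q, j, h1, h2, h3⟩ := H N.1 N.2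
    exact exists_injective_envelope j h3
  choose I ι hfin hinj hι hess using hull
  let next : St → St := fun N =>
    ⟨ModuleCat.of R (I N ⧸ LinearMap.range (ι N)),
      have := hfin N
      inferInstanceAs (Module.Finite R (I N ⧸ LinearMap.range (ι N)))⟩
  let seq : ℕ → St := fun k => Nat.rec ⟨ModuleCat.of R M, hM⟩ (fun _ N => next N) k
  let q : ∀ k, I (seq k) →ₗ[R] (seq (k + 1)).1 := fun k => (LinearMap.range (ι (seq k))).mkQ
  have hq : ∀ k, IsSES (ι (seq k)) (q k) := fun k => IsSES.mkQ (hι _)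
  have hd : ∀ k, LinearMap.range (ι (seq (k + 1)) ∘ₗ q k) = LinearMap.range (ι (seq (k + 1))) :=
    fun k => LinearMap.range_comp_of_range_eq_top _ (LinearMap.range_eq_top.2 (hq k).surj)
  have hex : ∀ k, Function.Exact (ι (seq k)) (ι (seq (k + 1)) ∘ₗ q k) := by
    intro k y
    rw [← (hq k).exact y, LinearMap.comp_apply,
      map_eq_zero_iff (ι (seq (k + 1))) (hι (seq (k + 1)))]
  let J : MinimalInjectiveResolution R M :=
    { I := fun k => I (seq k)
      ι := ι (seq 0)
      d := fun k => ι (seq (k + 1)) ∘ₗ q k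
      injective := fun k => hinj _
      ι_injective := hι (seq 0)
      exact_zero := hex 0
      exact_succ := fun k y => by
        have := hex (k + 1) y
        rw [this, ← LinearMap.coe_range, ← LinearMap.coe_range, hd k]
      ι_essential := hess (seq 0)
      d_essential := fun k => by rw [hd k]; exact hess _ }
  have key : ∀ k, ∀ m, k + m = n → DomDimGE R m (seq k).1 ∧
      (0 < m → Module.Projective R (I (seq k))) := by
    have hproj : ∀ k m, DomDimGE R m (seq k).1 → 0 < m → Module.Projective R (I (seq k)) := by
      intro k m hm h0
      have := (seq k).2
      have := hinj (seq k)
      exact (hm.mono h0).projective_of_essential (ι (seq k)) (hι _) (hess _)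
    intro k
    induction k with
    | zero =>
      intro m hm
      obtain rfl : m = n := by lia
      exact ⟨h, hproj 0 m h⟩
    | succ k ih =>
      intro m hm
      obtain ⟨h1, h2⟩ := ih (m + 1) (by lia)
      have := h2 (Nat.succ_pos m)
      have := hfin (seq k)
      have := hinj (seq k)
      have h3 : DomDimGE R m (seq (k + 1)).1 :=
        h1.right (hq k) DomDimGE.of_projective_injective
      exact ⟨h3, hproj (k + 1) m h3⟩
  exact ⟨J, fun i hi => (key i (n - i) (by lia)).2 (by lia)⟩

/-- For finitely generated modules over a suitable Artinian ring, the dominant dimension is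
detected by vanishing of `Ext`. -/
theorem le_domDim_iff [IsArtinianRing R] (H : HasFiniteInjectiveEmbeddings R)
    [Module.Finite R M] {n : ℕ} : (n : ℕ∞) ≤ domDim R M ↔ DomDimGE R n M := by
  refine ⟨DomDimGE.of_le_domDim, fun h => ?_⟩
  obtain ⟨J, hJ⟩ := h.exists_resolution H
  exact le_sSup ⟨n, rfl, J, hJ⟩

end DominantDimension

/-! ### Gorenstein projective and Gorenstein injective modules from classes of modules -/

section Trajectories

theorem exists_int_trajectory {σ : Type*} (Step : σ → σ → Prop)
    (fwd : ∀ s, ∃ t, Step s t) (bwd : ∀ s, ∃ t, Step t s) (s : σ) :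
    ∃ t : ℤ → σ, t 0 = s ∧ ∀ n, Step (t n) (t (n + 1)) := by
  choose F hF using fwd
  choose B hB using bwd
  let t : ℤ → σ := fun n => match n with
    | Int.ofNat n => F^[n] s
    | Int.negSucc n => B^[n + 1] s
  refine ⟨t, rfl, fun n => ?_⟩
  match n with
  | Int.ofNat n =>
    change Step (F^[n] s) (F^[n + 1] s)
    rw [Function.iterate_succ_apply']
    exact hF _
  | Int.negSucc 0 => exact hB s
  | Int.negSucc (n + 1) =>
    change Step (B^[n + 1 + 1] s) (B^[n + 1] s)
    rw [Function.iterate_succ_apply' B (n + 1)]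
    exact hB _

variable {R : Type u} [Ring R]

/-- Splicing: if every module of the class `C` is both a syzygy and a cosyzygy of modules of `C`,
and maps to finitely generated projective modules extend along monomorphisms with cokernel in `C`,
then the modules of `C` are Gorenstein projective. -/
theorem isGorensteinProjective_of_class (C : ModuleCat.{u} R → Prop)
    (fwd : ∀ X, C X → ∃ (P X' : ModuleCat.{u} R) (f : X →ₗ[R] P) (g : P →ₗ[R] X'),
      (Module.Finite R P ∧ Module.Projective R P) ∧ IsSES f g ∧ C X')
    (bwd : ∀ X, C X → ∃ (P X' : ModuleCat.{u} R) (f : X' →ₗ[R] P) (g : P →ₗ[R] X),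
      (Module.Finite R P ∧ Module.Projective R P) ∧ IsSES f g ∧ C X')
    (ext : ∀ (X P X' Q : ModuleCat.{u} R) (f : X →ₗ[R] P) (g : P →ₗ[R] X'), IsSES f g → C X' →
      Module.Finite R Q → Module.Projective R Q → ∀ φ : X →ₗ[R] Q, ∃ ψ : P →ₗ[R] Q, ψ ∘ₗ f = φ)
    (X : ModuleCat.{u} R) (hX : C X) : IsGorensteinProjective R X := by
  obtain ⟨t, h0, ht⟩ := exists_int_trajectory (σ := {X // C X})
    (fun X X' => ∃ (P : ModuleCat.{u} R) (f : X.1 →ₗ[R] P) (g : P →ₗ[R] X'.1),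
      (Module.Finite R P ∧ Module.Projective R P) ∧ IsSES f g)
    (fun X => by
      obtain ⟨P, X', f, g, h, h1, h2⟩ := fwd X.1 X.2
      exact ⟨⟨X', h2⟩, P, f, g, h, h1⟩)
    (fun X => by
      obtain ⟨P, X', f, g, h, h1, h2⟩ := bwd X.1 X.2
      exact ⟨⟨X', h2⟩, P, f, g, h, h1⟩) ⟨X, hX⟩
  choose P f g hP hfg using ht
  have hex : ∀ n, Function.Exact (f n) (f (n + 1) ∘ₗ g n) := fun n y => by
    rw [← (hfg n).exact y, LinearMap.comp_apply, map_eq_zero_iff _ (hfg (n + 1)).inj]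
  refine ⟨P, fun n => f (n + 1) ∘ₗ g n, hP, fun n y => ?_, fun Q hQ1 hQ2 n φ hφ => ?_, ?_⟩
  · rw [hex (n + 1) y, LinearMap.coe_comp, (hfg n).surj.range_comp]
  · obtain ⟨φ', rfl⟩ := (hfg (n + 1)).exists_desc φ (by
      ext x
      obtain ⟨y, rfl⟩ := (hfg n).surj x
      exact LinearMap.congr_fun hφ y)
    obtain ⟨ψ, hψ⟩ := ext _ _ _ Q _ _ (hfg (n + 1 + 1)) (t _).2 hQ1 hQ2 φ'
    exact ⟨ψ, by rw [← LinearMap.comp_assoc, hψ]⟩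
  · have e1 : Nonempty (X ≃ₗ[R] (t 0).1) := by rw [h0]; exact ⟨LinearEquiv.refl R X⟩
    have e2 : LinearMap.range (f 0) = LinearMap.ker (f (0 + 1) ∘ₗ g 0) :=
      (LinearMap.exact_iff.1 (hex 0)).symm
    exact ⟨e1.some.trans ((LinearEquiv.ofInjective (f 0) (hfg 0).inj).trans
      (LinearEquiv.ofEq _ _ e2))⟩

/-- The splicing argument for Gorenstein injective modules; here maps from finitely generated
injective modules lift along the epimorphisms in the short exact sequences. -/
theorem isGorensteinInjective_of_class (C : ModuleCat.{u} R → Prop)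
    (fwd : ∀ X, C X → ∃ (P X' : ModuleCat.{u} R) (f : X →ₗ[R] P) (g : P →ₗ[R] X'),
      (Module.Finite R P ∧ Module.Injective R P) ∧ IsSES f g ∧ C X')
    (bwd : ∀ X, C X → ∃ (P X' : ModuleCat.{u} R) (f : X' →ₗ[R] P) (g : P →ₗ[R] X),
      (Module.Finite R P ∧ Module.Injective R P) ∧ IsSES f g ∧ C X')
    (lift : ∀ (X P X' Q : ModuleCat.{u} R) (f : X →ₗ[R] P) (g : P →ₗ[R] X'), IsSES f g → C X →
      Module.Finite R P → C X' →
      Module.Finite R Q → Module.Injective R Q → ∀ φ : Q →ₗ[R] X', ∃ ψ : Q →ₗ[R] P, g ∘ₗ ψ = φ)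
    (X : ModuleCat.{u} R) (hX : C X) : IsGorensteinInjective R X := by
  obtain ⟨t, h0, ht⟩ := exists_int_trajectory (σ := {X // C X})
    (fun X X' => ∃ (P : ModuleCat.{u} R) (f : X.1 →ₗ[R] P) (g : P →ₗ[R] X'.1),
      (Module.Finite R P ∧ Module.Injective R P) ∧ IsSES f g)
    (fun X => by
      obtain ⟨P, X', f, g, h, h1, h2⟩ := fwd X.1 X.2
      exact ⟨⟨X', h2⟩, P, f, g, h, h1⟩)
    (fun X => by
      obtain ⟨P, X', f, g, h, h1, h2⟩ := bwd X.1 X.2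
      exact ⟨⟨X', h2⟩, P, f, g, h, h1⟩) ⟨X, hX⟩
  choose P f g hP hfg using ht
  have hex : ∀ n, Function.Exact (f n) (f (n + 1) ∘ₗ g n) := fun n y => by
    rw [← (hfg n).exact y, LinearMap.comp_apply, map_eq_zero_iff _ (hfg (n + 1)).inj]
  refine ⟨P, fun n => f (n + 1) ∘ₗ g n, hP, fun n y => ?_, fun Q hQ1 hQ2 n φ hφ => ?_, ?_⟩
  · rw [hex (n + 1) y, LinearMap.coe_comp, (hfg n).surj.range_comp]
  · obtain ⟨φ', rfl⟩ := (hfg (n + 1)).exists_lift φ (by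
      ext x
      refine (hfg (n + 1 + 1)).inj ?_
      rw [LinearMap.zero_apply, map_zero]
      exact LinearMap.congr_fun hφ x)
    obtain ⟨ψ, hψ⟩ := lift _ _ _ Q _ _ (hfg n) (t _).2 (hP n).1 (t _).2 hQ1 hQ2 φ'
    exact ⟨ψ, by rw [LinearMap.comp_assoc, hψ]⟩
  · have e1 : Nonempty (X ≃ₗ[R] (t 0).1) := by rw [h0]; exact ⟨LinearEquiv.refl R X⟩
    have e2 : LinearMap.range (f 0) = LinearMap.ker (f (0 + 1) ∘ₗ g 0) :=
      (LinearMap.exact_iff.1 (hex 0)).symm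
    exact ⟨e1.some.trans ((LinearEquiv.ofInjective (f 0) (hfg 0).inj).trans
      (LinearEquiv.ofEq _ _ e2))⟩

variable {M : Type u} [AddCommGroup M] [Module R M]

/-- Every Gorenstein projective module embeds into a finitely generated projective module with
Gorenstein projective cokernel. -/
theorem IsGorensteinProjective.exists_cosyzygy (h : IsGorensteinProjective R M) :
    ∃ (P X : ModuleCat.{u} R) (f : M →ₗ[R] P) (g : P →ₗ[R] X), Module.Finite R P ∧
      Module.Projective R P ∧ IsSES f g ∧ IsGorensteinProjective R X := by
  obtain ⟨P, d, hP, hd, hext, ⟨e⟩⟩ := h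
  refine ⟨P 0, ModuleCat.of R (LinearMap.ker (d (0 + 1))), (LinearMap.ker (d 0)).subtype ∘ₗ e,
    (d 0).codRestrict (LinearMap.ker (d (0 + 1))) fun x => (hd 0 _).2 ⟨x, rfl⟩,
    (hP 0).1, (hP 0).2, ⟨?_, ?_, ?_⟩, ?_⟩
  · exact (Submodule.injective_subtype _).comp e.injective
  · intro y
    rw [LinearMap.coe_comp, LinearEquiv.coe_coe, e.surjective.range_comp]
    rw [Subtype.ext_iff]
    change d 0 y = 0 ↔ _
    exact ⟨fun h => ⟨⟨y, h⟩, rfl⟩, by rintro ⟨⟨y, h⟩, rfl⟩; exact h⟩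
  · rintro ⟨y, hy⟩
    obtain ⟨x, rfl⟩ := (hd 0 _).1 hy
    exact ⟨x, rfl⟩
  · exact ⟨fun n => P (n + 1), fun n => d (n + 1), fun n => hP _, fun n => hd _,
      fun Q h1 h2 n => hext Q h1 h2 _, ⟨LinearEquiv.refl R _⟩⟩

end Trajectories

/-! ### Duality with respect to a bimodule -/

section Dual

variable {R : Type u} [Ring R] (S : Type u) [Ring S] (V : Type u) [AddCommGroup V] [Module R V]
  [Module S V] [SMulCommClass R S V]
  {X Y Z : Type u} [AddCommGroup X] [AddCommGroup Y]
  [AddCommGroup Z] [Module R X] [Module R Y] [Module R Z]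

/-- Precomposition with `f`, the functor `Hom_R(-, V)` from `R`-modules to `S`-modules on maps. -/
def homDual (f : X →ₗ[R] Y) : (Y →ₗ[R] V) →ₗ[S] (X →ₗ[R] V) where
  toFun φ := φ ∘ₗ f
  map_add' _ _ := rfl
  map_smul' _ _ := rfl

@[simp] theorem homDual_apply (f : X →ₗ[R] Y) (φ : Y →ₗ[R] V) (x : X) :
    homDual S V f φ x = φ (f x) := rfl

variable {f : X →ₗ[R] Y} {g : Y →ₗ[R] Z}

theorem IsSES.homDual (h : IsSES f g) (H : ∀ φ : X →ₗ[R] V, ∃ ψ : Y →ₗ[R] V, ψ ∘ₗ f = φ) :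
    IsSES (homDual S V g) (homDual S V f) where
  inj φ ψ hφ := by
    ext z
    obtain ⟨y, rfl⟩ := h.surj z
    exact LinearMap.congr_fun hφ y
  exact φ := by
    constructor
    · intro hφ
      obtain ⟨ψ, hψ⟩ := h.exists_desc φ hφ
      exact ⟨ψ, hψ⟩
    · rintro ⟨ψ, rfl⟩
      ext x
      have := LinearMap.congr_fun h.comp_eq_zero x
      simp only [LinearMap.comp_apply, LinearMap.zero_apply] at this
      simp [this]
  surj := H

/-- The dual of an isomorphism. -/
def homDualEquiv (e : X ≃ₗ[R] Y) : (Y →ₗ[R] V) ≃ₗ[S] (X →ₗ[R] V) :=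
  LinearEquiv.ofLinearMap (homDual S V e.toLinearMap) (homDual S V e.symm.toLinearMap)
    (by ext φ x; simp) (by ext φ x; simp)

variable [SMulCommClass S R V]

/-- The evaluation map of `X` into its double dual with respect to the bimodule `V`. -/
def homEval (X : Type u) [AddCommGroup X] [Module R X] : X →ₗ[R] ((X →ₗ[R] V) →ₗ[S] V) where
  toFun x :=
    { toFun := fun φ => φ x
      map_add' := fun _ _ => rfl
      map_smul' := fun _ _ => rfl }
  map_add' x y := by ext φ; exact map_add φ x y
  map_smul' r x := by ext φ; exact map_smul φ r x

@[simp] theorem homEval_apply (x : X) (φ : X →ₗ[R] V) : homEval S V X x φ = φ x := rfl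

end Dual

/-! ### Bimodules that are free of rank one on both sides -/

section Regular

/-- `u` is a generator of the bimodule `U`, which is free of rank one over each of the two rings.
For `U = A`, `R = A` and `S = Aᵐᵒᵖ` this is the regular bimodule; the two sides play symmetric
roles. -/
structure IsRegularGenerator (R S : Type u) [Ring R] [Ring S] {U : Type u} [AddCommGroup U]
    [Module R U] [Module S U] (u : U) : Prop where
  left : Function.Bijective fun r : R => r • u
  right : Function.Bijective fun s : S => s • u

variable {R S : Type u} [Ring R] [Ring S] {U : Type u} [AddCommGroup U]
    [Module R U] [Module S U] {u : U}
    {V : Type u} [AddCommGroup V] [Module R V] [Module S V] [SMulCommClass R S V]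
    {X : Type u} [AddCommGroup X] [Module R X]

namespace IsRegularGenerator

theorem symm (h : IsRegularGenerator R S u) : IsRegularGenerator S R u := ⟨h.right, h.left⟩

/-- The isomorphism `R ≃ U` given by the generator. -/
noncomputable def equiv (h : IsRegularGenerator R S u) : R ≃ₗ[R] U :=
  LinearEquiv.ofBijective (LinearMap.toSpanSingleton R U u) h.left

theorem equiv_apply (h : IsRegularGenerator R S u) (r : R) : h.equiv r = r • u := rfl

theorem finite (h : IsRegularGenerator R S u) : Module.Finite R U := Module.Finite.equiv h.equiv

/-- The `R`-basis of `Uⁿ` given by the generator. -/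
noncomputable def basis (h : IsRegularGenerator R S u) (n : ℕ) :
    Module.Basis (Fin n) R (Fin n → U) :=
  Module.Basis.ofEquivFun (LinearEquiv.piCongrRight fun _ => h.equiv.symm)

theorem projective_pi (h : IsRegularGenerator R S u) (n : ℕ) : Module.Projective R (Fin n → U) :=
  Module.Projective.of_basis (h.basis n)

theorem basis_apply (h : IsRegularGenerator R S u) (n : ℕ) (k : Fin n) :
    h.basis n k = Pi.single k u := by
  classical
  rw [basis, Module.Basis.coe_ofEquivFun]
  change (fun i => h.equiv (Function.update (0 : Fin n → R) k 1 i)) = _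
  ext i
  by_cases hi : i = k
  · subst hi; simp [equiv_apply]
  · simp [hi]

theorem exists_surjective (h : IsRegularGenerator R S u) [Module.Finite R X] :
    ∃ (n : ℕ) (p : (Fin n → U) →ₗ[R] X), Function.Surjective p := by
  obtain ⟨n, p, hp⟩ := Module.Finite.exists_fin' R X
  exact ⟨n, p ∘ₗ (LinearEquiv.piCongrRight fun _ => h.equiv.symm).toLinearMap,
    hp.comp (LinearEquiv.surjective _)⟩

/-- `Hom_R(Uⁿ, V) ≃ Vⁿ`, by evaluation at the standard basis. -/
noncomputable def homEquiv (h : IsRegularGenerator R S u) (n : ℕ) :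
    ((Fin n → U) →ₗ[R] V) ≃ₗ[S] (Fin n → V) :=
  ((h.basis n).constr S).symm

theorem homEquiv_apply (h : IsRegularGenerator R S u) (n : ℕ) (φ : (Fin n → U) →ₗ[R] V)
    (k : Fin n) : h.homEquiv n φ k = φ (Pi.single k u) := by
  rw [← h.basis_apply]; rfl

variable [SMulCommClass R S U] [SMulCommClass S R U]

/-- Finite powers of `U` are reflexive. -/
theorem exists_eq_eval (h : IsRegularGenerator R S u) {n : ℕ}
    (G : ((Fin n → U) →ₗ[R] U) →ₗ[S] U) : ∃ y : Fin n → U, ∀ φ, G φ = φ y := by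
  classical
  let Φ : ((Fin n → U) →ₗ[R] U) ≃ₗ[S] (Fin n → U) := h.homEquiv n
  choose r hr using fun k => h.left.2 (G (Φ.symm (Pi.single k u)))
  refine ⟨∑ k, r k • Pi.single k u, fun φ => ?_⟩
  choose s hs using fun k => h.right.2 (φ (Pi.single k u))
  have hφ : φ = ∑ k, s k • Φ.symm (Pi.single k u) := by
    apply Φ.injective
    rw [map_sum]
    ext i
    rw [Finset.sum_apply, h.homEquiv_apply]
    simp only [map_smul, LinearEquiv.apply_symm_apply, Pi.smul_apply, Pi.single_apply]
    simp [← hs i]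
  rw [map_sum]
  conv_lhs => rw [hφ, map_sum]
  refine Finset.sum_congr rfl fun k _ => ?_
  simp only at hr hs
  rw [map_smul, map_smul, ← hr k, ← hs k, smul_comm]

end IsRegularGenerator

end Regular

/-! ### Left-right symmetry of the dominant dimension -/

section Symmetry

/-- One half of a Morita duality given by the bimodule `E`: over `R`, it is injective, all finitely
generated modules are reflexive, and their duals are finitely generated. -/
structure IsHalfDuality (R S E : Type u) [Ring R] [Ring S] [AddCommGroup E] [Module R E]
    [Module S E] [SMulCommClass R S E] [SMulCommClass S R E] : Prop where
  injective : Module.Injective R E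
  reflexive : ∀ X : ModuleCat.{u} R, Module.Finite R X → Function.Bijective (homEval (R := R) S E X)
  finite : ∀ X : ModuleCat.{u} R, Module.Finite R X → Module.Finite S (X →ₗ[R] E)

variable {R S : Type u} [Ring R] [Ring S] {U : Type u} [AddCommGroup U]
    [Module R U] [Module S U] {u : U}
    {V : Type u} [AddCommGroup V] [Module R V] [Module S V] [SMulCommClass R S V]
    {E : Type u} [AddCommGroup E] [Module R E] [Module S E] [SMulCommClass R S E]
    {X : Type u} [AddCommGroup X] [Module R X]

namespace IsRegularGenerator

theorem dual_injective (hu : IsRegularGenerator R S u) [Module.Finite R X]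
    [Module.Projective R X] [Module.Injective S V] : Module.Injective S (X →ₗ[R] V) := by
  obtain ⟨n, p, hp⟩ := hu.exists_surjective (X := X)
  obtain ⟨s, hs⟩ := Module.projective_lifting_property p LinearMap.id hp
  have h1 : Module.Injective S ((Fin n → U) →ₗ[R] V) :=
    Module.Injective.of_retract (hu.homEquiv (V := V) n).toLinearMap
      (hu.homEquiv (V := V) n).symm.toLinearMap
      (LinearMap.ext fun φ => (hu.homEquiv (V := V) n).symm_apply_apply φ)
  refine Module.Injective.of_retract (homDual S V p) (homDual S V s) ?_
  ext φ x
  simpa using congrArg φ (LinearMap.congr_fun hs x)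

variable [SMulCommClass S R E]

/-- Every finitely generated `R`-module embeds into the `E`-dual of some `Uⁿ`. -/
theorem exists_embedding_dual (hu : IsRegularGenerator R S u) (hE : IsHalfDuality R S E)
    [Module.Finite R X] : ∃ (n : ℕ) (j : X →ₗ[R] ((Fin n → U) →ₗ[S] E)),
      Function.Injective j := by
  have := hE.finite (ModuleCat.of R X) ‹_›
  obtain ⟨n, p, hp⟩ := hu.symm.exists_surjective (X := X →ₗ[R] E)
  refine ⟨n, homDual R E p ∘ₗ homEval S E X, fun x y hxy => ?_⟩
  apply (hE.reflexive (ModuleCat.of R X) ‹_›).1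
  ext φ
  obtain ⟨z, rfl⟩ := hp φ
  exact LinearMap.congr_fun hxy z

theorem hasFiniteInjectiveEmbeddings (hu : IsRegularGenerator R S u) (hE : IsHalfDuality R S E)
    (hE' : IsHalfDuality S R E) : HasFiniteInjectiveEmbeddings R := by
  intro N hN
  obtain ⟨n, j, hj⟩ := hu.exists_embedding_dual hE (X := N)
  have := hu.symm.finite
  have := hu.symm.projective_pi
  have := hE.injective
  exact ⟨ModuleCat.of R ((Fin n → U) →ₗ[S] E), j, hE'.finite (ModuleCat.of S (Fin n → U))
    (inferInstanceAs (Module.Finite S (Fin n → U))), hu.symm.dual_injective, hj⟩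

theorem dual_projective (hu : IsRegularGenerator R S u) (hE : IsHalfDuality R S E)
    (hE' : IsHalfDuality S R E) [Module.Finite R X] [Module.Injective R X] :
    Module.Projective S (X →ₗ[R] E) := by
  obtain ⟨n, j, hj⟩ := hu.exists_embedding_dual hE (X := X)
  obtain ⟨r, hr⟩ := Module.Injective.out j hj LinearMap.id
  have := hu.symm.finite
  have := hu.symm.projective_pi
  let e : (Fin n → U) ≃ₗ[S] (((Fin n → U) →ₗ[S] E) →ₗ[R] E) :=
    LinearEquiv.ofBijective (homEval R E (Fin n → U))
      (hE'.reflexive (ModuleCat.of S (Fin n → U))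
        (inferInstanceAs (Module.Finite S (Fin n → U))))
  have : Module.Projective S (((Fin n → U) →ₗ[S] E) →ₗ[R] E) := Module.Projective.of_equiv e
  refine Module.Projective.of_split (homDual S E r) (homDual S E j) ?_
  ext φ x
  simpa using congrArg φ (hr x)

/-- If the regular module embeds into a projective-injective module `X` over `R`, then over `S` it
is cogenerated by the projective-injective module `D X`. -/
theorem domDimGE_one_symm [IsArtinianRing R] (hu : IsRegularGenerator R S u)
    (hE : IsHalfDuality R S E) (hE' : IsHalfDuality S R E) (h : DomDimGE R 1 U) :
    DomDimGE S 1 U := by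
  intro T hT i hi
  obtain rfl : i = 0 := by lia
  rw [ExtVanish.zero_iff]
  intro φ
  have := hu.finite
  have := hu.symm.finite
  have := hE.injective
  have := hE'.injective
  obtain ⟨X, j, hX1, hX2, hX3, hj⟩ := h.exists_embedding
  ext t
  obtain ⟨s, hs : s • u = φ t⟩ := hu.right.2 (φ t)
  have hsE : ∀ e : E, s • e = 0 := by
    intro e
    obtain ⟨y, hy⟩ := Module.Injective.out j hj
      (LinearMap.toSpanSingleton R E e ∘ₗ hu.equiv.symm.toLinearMap)
    have hju : y (j u) = e := by
      have h1 : hu.equiv.symm u = 1 := by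
        rw [LinearEquiv.symm_apply_eq, hu.equiv_apply, one_smul]
      rw [hy, LinearMap.comp_apply, LinearEquiv.coe_coe, h1, LinearMap.toSpanSingleton_apply,
        one_smul]
    have h2 := hT.2 (ModuleCat.of S (X →ₗ[R] E)) (hE.finite X hX1) (hu.dual_projective hE hE')
      hu.dual_injective (LinearMap.toSpanSingleton S (X →ₗ[R] E) y ∘ₗ
        hu.symm.equiv.symm.toLinearMap ∘ₗ φ)
    have h3 : hu.symm.equiv.symm (φ t) = s := by
      rw [LinearEquiv.symm_apply_eq, hu.symm.equiv_apply, hs]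
    have h4 := LinearMap.congr_fun h2 t
    simp only [LinearMap.comp_apply, LinearEquiv.coe_coe, h3, LinearMap.toSpanSingleton_apply,
      LinearMap.zero_apply] at h4
    have h5 := LinearMap.congr_fun h4 (j u)
    rwa [LinearMap.smul_apply, hju] at h5
  apply (hE'.reflexive (ModuleCat.of S U) ‹_›).1
  ext ψ
  rw [homEval_apply, ← hs, map_smul, hsE]
  simp

variable [SMulCommClass R S U] [SMulCommClass S R U]

/-- The inductive step for the symmetry of the dominant dimension, along a free resolution of `T`.
The cohomology of the dual of the resolution has no nonzero maps to projective-injective modules,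
since such maps are given by elements of the resolution itself; on the other hand it embeds, in low
degrees, into a module of positive dominant dimension, so it vanishes there. -/
theorem extVanish_of_domDimGE_dual [IsNoetherianRing R] [IsNoetherianRing S]
    (hu : IsRegularGenerator R S u) {n : ℕ} (hn : DomDimGE R n U) (m : ℕ) (hm : m < n) :
    ∀ (T : Type u) [AddCommGroup T] [Module S T] [Module.Finite S T],
      DomDimGE R (m + 2) (T →ₗ[S] U) → ∀ i < m, ExtVanish S T U (i + 1) := by
  induction m with
  | zero => intro T _ _ _ _ i hi; exact absurd hi (Nat.not_lt_zero i)
  | succ m ih =>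
    intro T _ _ _ hT
    have := hu.finite
    have := hu.symm.finite
    have := hu.symm.projective_pi
    have hfree : ∀ k, DomDimGE R n ((Fin k → U) →ₗ[S] U) := fun k =>
      (hn.pi k).congr (hu.symm.homEquiv k).symm
    obtain ⟨a, p, hp⟩ := hu.symm.exists_surjective (X := T)
    have hses := IsSES.ker_subtype hp
    let ι := (LinearMap.ker p).subtype
    obtain ⟨b, p', hp'⟩ := hu.symm.exists_surjective (X := LinearMap.ker p)
    let α : ((Fin a → U) →ₗ[S] U) →ₗ[R] ((Fin b → U) →ₗ[S] U) := homDual R U (ι ∘ₗ p')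
    have hB : DomDimGE R (m + 2) (LinearMap.range α) := by
      have h1 : IsSES (homDual R U p) α.rangeRestrict := by
        refine ⟨fun φ ψ h => ?_, fun φ => ?_, LinearMap.surjective_rangeRestrict _⟩
        · ext t
          obtain ⟨x, rfl⟩ := hp t
          exact LinearMap.congr_fun h x
        · constructor
          · intro hφ
            obtain ⟨θ, hθ⟩ := hses.exists_desc φ (by
              ext k
              obtain ⟨x, rfl⟩ := hp' k
              exact LinearMap.congr_fun (congrArg Subtype.val hφ) x)
            exact ⟨θ, hθ⟩
          · rintro ⟨θ, rfl⟩
            apply Subtype.ext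
            refine LinearMap.ext fun x => ?_
            change θ (p (p' x)) = 0
            rw [LinearMap.mem_ker.1 (p' x).2, map_zero]
      exact DomDimGE.right h1 hT ((hfree a).mono (by lia))
    have hC : DomDimGE R (m + 1) (((Fin b → U) →ₗ[S] U) ⧸ LinearMap.range α) :=
      DomDimGE.right (f := (LinearMap.range α).subtype) (g := (LinearMap.range α).mkQ)
        ⟨Submodule.injective_subtype _, LinearMap.exact_subtype_mkQ _,
          Submodule.mkQ_surjective _⟩ hB ((hfree b).mono (by lia))
    let β : (LinearMap.ker p →ₗ[S] U) →ₗ[R] ((Fin b → U) →ₗ[S] U) ⧸ LinearMap.range α :=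
      (LinearMap.range α).mkQ ∘ₗ homDual R U p'
    have hFfin : Module.Finite R ((Fin b → U) →ₗ[S] U) :=
      Module.Finite.equiv (hu.symm.homEquiv (V := U) b).symm
    have htors : IsDomTorsion R (LinearMap.range β) := by
      refine ⟨inferInstance, fun Y hY1 hY2 hY3 χ => ?_⟩
      obtain ⟨χ', hχ'⟩ := Module.Injective.out (LinearMap.range β).subtype
        (Submodule.injective_subtype _) χ
      obtain ⟨c, q, hq⟩ := hu.exists_surjective (X := Y)
      obtain ⟨s, hs⟩ := Module.projective_lifting_property q LinearMap.id hq
      ext ⟨_, φ, rfl⟩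
      rw [← hχ']
      have hsinj : Function.Injective s := fun x y hxy => by
        rw [← LinearMap.id_apply (R := R) x, ← LinearMap.id_apply (R := R) y, ← hs]
        simp [hxy]
      apply hsinj
      rw [LinearMap.zero_apply, map_zero]
      ext k
      -- A linear form on the dual of a free module is the evaluation at an element.
      obtain ⟨y, hy⟩ := hu.symm.exists_eq_eval
        (LinearMap.proj (R := R) (φ := fun _ : Fin c => U) k ∘ₗ s ∘ₗ χ' ∘ₗ
          (LinearMap.range α).mkQ)
      have hy0 : p' y = 0 := by
        apply Subtype.ext
        ext i
        have h1 := hy (α (LinearMap.proj (R := S) (φ := fun _ : Fin a => U) i))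
        have h2 : (LinearMap.range α).mkQ
            (α (LinearMap.proj (R := S) (φ := fun _ : Fin a => U) i)) = 0 :=
          (Submodule.Quotient.mk_eq_zero _).2 ⟨_, rfl⟩
        simp only [LinearMap.comp_apply, h2, map_zero] at h1
        exact h1.symm
      have h3 := hy (homDual R U p' φ)
      rw [homDual_apply, hy0, map_zero] at h3
      exact h3
    have hext : ∀ φ : LinearMap.ker p →ₗ[S] U, ∃ ψ : (Fin a → U) →ₗ[S] U, ψ ∘ₗ ι = φ := by
      intro φ
      have h0 := ExtVanish.zero_iff.1
        (hC (ModuleCat.of R (LinearMap.range β)) htors 0 (Nat.succ_pos m))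
        (LinearMap.range β).subtype
      have h1 : β φ = 0 := LinearMap.congr_fun h0 ⟨β φ, φ, rfl⟩
      obtain ⟨ψ, hψ⟩ := (Submodule.Quotient.mk_eq_zero _).1 h1
      refine ⟨ψ, ?_⟩
      ext k
      obtain ⟨x, rfl⟩ := hp' k
      exact LinearMap.congr_fun hψ x
    have hK : DomDimGE R (m + 2) (LinearMap.ker p →ₗ[S] U) :=
      DomDimGE.right (hses.homDual R U hext) hT ((hfree a).mono (by lia))
    intro i hi
    cases i with
    | zero => exact ExtVanish.one_of_extend hses hext
    | succ i =>
      exact (ih (by lia) (LinearMap.ker p) hK i (by lia)).contra_right hses ExtVanish.of_projective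

/-- The dominant dimension of the regular module is left-right symmetric. -/
theorem domDimGE_symm [IsArtinianRing R] [IsArtinianRing S] (hu : IsRegularGenerator R S u)
    (hE : IsHalfDuality R S E) (hE' : IsHalfDuality S R E) {n : ℕ} (h : DomDimGE R n U) :
    DomDimGE S n U := by
  intro T hT i hi
  have h1 := hu.domDimGE_one_symm hE hE' (h.mono (by lia)) T hT 0 one_pos
  cases i with
  | zero => exact h1
  | succ i =>
    have := hT.1
    refine hu.extVanish_of_domDimGE_dual h (i + 1) hi T ?_ i (Nat.lt_succ_self i)
    have h2 : Subsingleton (T →ₗ[S] U) :=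
      subsingleton_of_forall_eq 0 (ExtVanish.zero_iff.1 h1)
    intro T' _ k _
    cases k with
    | zero => exact ExtVanish.zero_iff.2 fun φ => LinearMap.ext fun t => Subsingleton.elim _ _
    | succ k =>
      have : Module.Injective R (T →ₗ[S] U) :=
        ⟨fun A B _ _ _ _ _ _ φ => ⟨0, fun x => Subsingleton.elim _ _⟩⟩
      exact ExtVanish.of_injective

end IsRegularGenerator

end Symmetry

/-! ### Gorenstein projective modules over Gorenstein rings -/

section Gorenstein

/-- `Ext^i(M, U) = 0` for all `i > j`. Over a Gorenstein ring with regular module `U` and for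
finitely generated `M`, this says that the Gorenstein projective dimension is at most `j`. -/
def GorDimLE (R U : Type u) [Ring R] [AddCommGroup U] [Module R U] (j : ℕ) (M : Type u)
    [AddCommGroup M] [Module R M] : Prop :=
  ∀ i, j < i → ExtVanish R M U i

/-- The injective dimension of `U` is at most `r`. -/
def InjDimLE (R U : Type u) [Ring R] [AddCommGroup U] [Module R U] (r : ℕ) : Prop :=
  ∀ M : ModuleCat.{u} R, GorDimLE R U r M

variable {R S : Type u} [Ring R] [Ring S] {U : Type u} [AddCommGroup U]
    [Module R U] [Module S U] {u : U}
    {X Y Z : Type u} [AddCommGroup X] [Module R X] [AddCommGroup Y] [Module R Y]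
    [AddCommGroup Z] [Module R Z]
    {f : X →ₗ[R] Y} {g : Y →ₗ[R] Z} {j : ℕ}

namespace GorDimLE

theorem congr (e : X ≃ₗ[R] Y) (h : GorDimLE R U j X) : GorDimLE R U j Y :=
  fun i hi => (h i hi).congr_left e

theorem of_projective [Module.Projective R X] : GorDimLE R U j X := by
  intro i hi
  obtain ⟨k, rfl⟩ := Nat.exists_eq_add_of_lt hi
  exact ExtVanish.of_projective

theorem left (h : IsSES f g) [Module.Projective R Y] (hZ : GorDimLE R U (j + 1) Z) :
    GorDimLE R U j X :=
  fun i hi => ExtVanish.contra_left h (of_projective (j := j) i hi) (hZ (i + 1) (by lia))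

theorem mono {k : ℕ} (hjk : j ≤ k) (h : GorDimLE R U j X) : GorDimLE R U k X :=
  fun i hi => h i (hjk.trans_lt hi)

/-- If `Ext^i(Z, U) = 0` for `i ≥ 1`, maps to finitely generated projective modules extend
along monomorphisms with cokernel `Z`. -/
theorem exists_extend (hu : IsRegularGenerator R S u) (h : IsSES f g)
    (hZ : GorDimLE R U 0 Z) {Q : Type u} [AddCommGroup Q] [Module R Q] [Module.Finite R Q]
    [Module.Projective R Q] (φ : X →ₗ[R] Q) : ∃ ψ : Y →ₗ[R] Q, ψ ∘ₗ f = φ := by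
  obtain ⟨c, q, hq⟩ := hu.exists_surjective (X := Q)
  obtain ⟨s, hs⟩ := Module.projective_lifting_property q LinearMap.id hq
  choose ψ hψ using fun k => ExtVanish.exists_extend h (hZ 1 one_pos)
    (LinearMap.proj (R := R) (φ := fun _ : Fin c => U) k ∘ₗ s ∘ₗ φ)
  refine ⟨q ∘ₗ LinearMap.pi ψ, ?_⟩
  have : LinearMap.pi ψ ∘ₗ f = s ∘ₗ φ := by
    ext x k
    exact LinearMap.congr_fun (hψ k) x
  rw [LinearMap.comp_assoc, this, ← LinearMap.comp_assoc, hs, LinearMap.id_comp]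

variable [SMulCommClass R S U]

theorem dual_ses (h : IsSES f g) (hZ : GorDimLE R U 0 Z) :
    IsSES (homDual S U g) (homDual S U f) :=
  h.homDual S U (ExtVanish.exists_extend h (hZ 1 one_pos))

/-- Dimension shifting along a free resolution of `X`: its dual is an exact coresolution of the
dual of `X`, so that this dual is an arbitrarily high syzygy. -/
theorem dual [IsNoetherianRing R] (hu : IsRegularGenerator R S u) {r : ℕ} (hS : InjDimLE S U r)
    [Module.Finite R X] (hX : GorDimLE R U 0 X) : GorDimLE S U 0 (X →ₗ[R] U) := by
  have key : ∀ k : ℕ, ∀ (X : Type u) [AddCommGroup X] [Module R X] [Module.Finite R X],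
      GorDimLE R U 0 X → ∀ i, 0 < i → r < i + k → ExtVanish S (X →ₗ[R] U) U i := by
    intro k
    induction k with
    | zero => intro X _ _ _ _ i _ hi; exact hS (ModuleCat.of S (X →ₗ[R] U)) i hi
    | succ k ih =>
      intro X _ _ _ hX i hi0 hi
      have := hu.finite
      have := hu.projective_pi
      have := hu.symm.projective_pi
      obtain ⟨a, p, hp⟩ := hu.exists_surjective (X := X)
      have hses := IsSES.ker_subtype hp
      have hK : GorDimLE R U 0 (LinearMap.ker p) := left hses (hX.mono (Nat.zero_le 1))
      have : Module.Projective S ((Fin a → U) →ₗ[R] U) :=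
        Module.Projective.of_equiv (hu.homEquiv (V := U) a).symm
      exact ExtVanish.contra_left (dual_ses hses hX) (of_projective (j := 0) i hi0)
        (ih _ hK (i + 1) (Nat.succ_pos i) (by lia))
  exact fun i hi => key (r + 1) X hX i hi (by lia)

variable [SMulCommClass S R U]

theorem exists_eq_eval [IsNoetherianRing R] (hu : IsRegularGenerator R S u) {r : ℕ}
    (hS : InjDimLE S U r) [Module.Finite R X] (hX : GorDimLE R U 0 X)
    (G : (X →ₗ[R] U) →ₗ[S] U) : ∃ x : X, ∀ φ, G φ = φ x := by
  have := hu.finite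
  have := hu.projective_pi
  obtain ⟨a, p, hp⟩ := hu.exists_surjective (X := X)
  have hses := IsSES.ker_subtype hp
  have hK : GorDimLE R U 0 (LinearMap.ker p) := left hses (hX.mono (Nat.zero_le 1))
  obtain ⟨G', hG'⟩ := ExtVanish.exists_extend (dual_ses (S := S) hses hX)
    (hK.dual hu hS 1 one_pos) G
  obtain ⟨y, hy⟩ := hu.exists_eq_eval G'
  refine ⟨p y, fun φ => ?_⟩
  rw [← hG']
  exact hy _

/-- Linear forms separate the elements of a finitely generated module `X` with `Ext^i(X, U) = 0`
for `i ≥ 1`: an element of the covering free module at which all forms on `X` vanish induces a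
form on the dual of the syzygy, hence comes from the syzygy. -/
theorem eq_zero_of_forall [IsNoetherianRing R] (hu : IsRegularGenerator R S u) {r : ℕ}
    (hS : InjDimLE S U r) [Module.Finite R X] (hX : GorDimLE R U 0 X) (x : X)
    (hx : ∀ φ : X →ₗ[R] U, φ x = 0) : x = 0 := by
  have := hu.finite
  have := hu.projective_pi
  obtain ⟨a, p, hp⟩ := hu.exists_surjective (X := X)
  have hses := IsSES.ker_subtype hp
  have hK : GorDimLE R U 0 (LinearMap.ker p) := left hses (hX.mono (Nat.zero_le 1))
  obtain ⟨y, rfl⟩ := hp x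
  obtain ⟨G, hG⟩ := (dual_ses (S := S) hses hX).exists_desc (homEval S U _ y) (by
    ext φ
    exact hx φ)
  obtain ⟨z, hz⟩ := hK.exists_eq_eval hu hS G
  have hyz : y = z := by
    ext i
    have h1 := LinearMap.congr_fun hG (LinearMap.proj (R := R) (φ := fun _ : Fin a => U) i)
    rw [LinearMap.comp_apply, hz] at h1
    exact h1.symm
  rw [hyz]
  exact z.2

/-- A finite generating set of the dual of `X` gives an embedding of `X` into a free module along
which all linear forms extend. -/
theorem exists_cosyzygy [IsNoetherianRing R] [IsNoetherianRing S]
    (hu : IsRegularGenerator R S u) {r : ℕ}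
    (hS : InjDimLE S U r) [Module.Finite R X] (hX : GorDimLE R U 0 X) :
    ∃ (P X' : ModuleCat.{u} R) (f : X →ₗ[R] P) (g : P →ₗ[R] X'), Module.Finite R P ∧
      Module.Projective R P ∧ IsSES f g ∧ Module.Finite R X' ∧ GorDimLE R U 0 X' := by
  have := hu.finite
  have := hu.symm.finite
  have := hu.projective_pi
  obtain ⟨a, p, hp⟩ := hu.exists_surjective (X := X)
  have : Module.Finite S ((Fin a → U) →ₗ[R] U) :=
    Module.Finite.equiv (hu.homEquiv (V := U) a).symm
  have : Module.Finite S (X →ₗ[R] U) := Module.Finite.of_injective (homDual S U p)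
    fun φ ψ h => by
      ext x
      obtain ⟨y, rfl⟩ := hp x
      exact LinearMap.congr_fun h y
  obtain ⟨b, q, hq⟩ := hu.symm.exists_surjective (X := X →ₗ[R] U)
  have hP1 : Module.Finite R ((Fin b → U) →ₗ[S] U) :=
    Module.Finite.equiv (hu.symm.homEquiv (V := U) b).symm
  have hP2 : Module.Projective R ((Fin b → U) →ₗ[S] U) :=
    Module.Projective.of_equiv (hu.symm.homEquiv (V := U) b).symm
  let f : X →ₗ[R] ((Fin b → U) →ₗ[S] U) := homDual R U q ∘ₗ homEval S U X
  have hf : Function.Injective f := by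
    rw [← LinearMap.ker_eq_bot, Submodule.eq_bot_iff]
    intro x hx
    refine hX.eq_zero_of_forall hu hS x fun φ => ?_
    obtain ⟨y, rfl⟩ := hq φ
    exact LinearMap.congr_fun hx y
  have hses := IsSES.mkQ hf
  refine ⟨ModuleCat.of R ((Fin b → U) →ₗ[S] U), ModuleCat.of R (_ ⧸ LinearMap.range f), f, _,
    hP1, hP2, hses, inferInstanceAs (Module.Finite R (_ ⧸ LinearMap.range f)), fun i hi => ?_⟩
  cases i with
  | zero => exact absurd hi (lt_irrefl 0)
  | succ i =>
    cases i with
    | zero =>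
      refine ExtVanish.one_of_extend hses fun φ => ?_
      obtain ⟨y, rfl⟩ := hq φ
      exact ⟨homEval R U _ y, rfl⟩
    | succ i =>
      exact ExtVanish.contra_right hses (hX (i + 1) (Nat.succ_pos i)) ExtVanish.of_projective

theorem isGorensteinProjective [IsNoetherianRing R] [IsNoetherianRing S]
    (hu : IsRegularGenerator R S u) {r : ℕ} (hS : InjDimLE S U r) [Module.Finite R X]
    (hX : GorDimLE R U 0 X) : IsGorensteinProjective R X := by
  refine isGorensteinProjective_of_class
    (fun X => Module.Finite R X ∧ GorDimLE R U 0 X) ?_ ?_ ?_ (ModuleCat.of R X) ⟨‹_›, hX⟩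
  · rintro X ⟨h1, h2⟩
    obtain ⟨P, X', f, g, hP1, hP2, h, h3, h4⟩ := h2.exists_cosyzygy hu hS
    exact ⟨P, X', f, g, ⟨hP1, hP2⟩, h, h3, h4⟩
  · rintro X ⟨h1, h2⟩
    have := hu.finite
    have := hu.projective_pi
    obtain ⟨a, p, hp⟩ := hu.exists_surjective (X := X)
    exact ⟨ModuleCat.of R (Fin a → U), ModuleCat.of R (LinearMap.ker p),
      (LinearMap.ker p).subtype, p, ⟨inferInstanceAs (Module.Finite R (Fin a → U)),
        inferInstanceAs (Module.Projective R (Fin a → U))⟩, IsSES.ker_subtype hp,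
      inferInstanceAs (Module.Finite R (LinearMap.ker p)),
      left (IsSES.ker_subtype hp) (h2.mono (Nat.zero_le 1))⟩
  · rintro X P X' Q f g h ⟨_, h2⟩ hQ1 hQ2 φ
    exact h2.exists_extend hu h φ

theorem hasGorProjResolution [IsNoetherianRing R] [IsNoetherianRing S]
    (hu : IsRegularGenerator R S u) {r : ℕ} (hS : InjDimLE S U r) (j : ℕ) :
    ∀ (M : Type u) [AddCommGroup M] [Module R M] [Module.Finite R M],
      GorDimLE R U j M → HasGorProjResolution R j M := by
  induction j with
  | zero => intro M _ _ _ hM; exact hM.isGorensteinProjective hu hS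
  | succ j ih =>
    intro M _ _ _ hM
    have := hu.finite
    have := hu.projective_pi
    obtain ⟨a, p, hp⟩ := hu.exists_surjective (X := M)
    exact ⟨ModuleCat.of R (Fin a → U), p,
      GorDimLE.isGorensteinProjective (X := Fin a → U) hu hS GorDimLE.of_projective, hp,
      ih _ (left (IsSES.ker_subtype hp) hM)⟩

end GorDimLE

/-! ### Dominant dimension and Gorenstein projective dimension -/

/-- A module of dominant dimension at least `n` is an `n`-th syzygy. -/
theorem DomDimGE.gorDimLE [IsArtinianRing R] {r : ℕ} (hR : InjDimLE R U r) (n : ℕ) (hn : n ≤ r) :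
    ∀ (M : Type u) [AddCommGroup M] [Module R M] [Module.Finite R M], DomDimGE R n M →
      GorDimLE R U (r - n) M := by
  induction n with
  | zero => intro M _ _ _ _; exact hR (ModuleCat.of R M)
  | succ n ih =>
    intro M _ _ _ hM
    obtain ⟨P, φ, h1, h2, h3, hφ⟩ := (hM.mono (Nat.succ_pos n)).exists_embedding
    have hses := IsSES.mkQ hφ
    have h4 := ih (by lia) _ (hM.right hses DomDimGE.of_projective_injective)
    rw [show r - n = r - (n + 1) + 1 by lia] at h4
    exact GorDimLE.left hses h4

theorem DomDimGE.of_projective (hu : IsRegularGenerator R S u) {n : ℕ} (hn : DomDimGE R n U)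
    [Module.Finite R X] [Module.Projective R X] : DomDimGE R n X := by
  obtain ⟨c, q, hq⟩ := hu.exists_surjective (X := X)
  obtain ⟨s, hs⟩ := Module.projective_lifting_property q LinearMap.id hq
  exact (hn.pi c).of_retract s q hs

theorem IsGorensteinProjective.domDimGE (hu : IsRegularGenerator R S u) {r : ℕ}
    (hr : DomDimGE R r U) (n : ℕ) (hn : n ≤ r) :
    ∀ (M : Type u) [AddCommGroup M] [Module R M], IsGorensteinProjective R M →
      DomDimGE R n M := by
  induction n with
  | zero => intro M _ _ _; exact DomDimGE.zero
  | succ n ih =>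
    intro M _ _ hM
    obtain ⟨P, X, f, g, h1, h2, hses, hX⟩ := hM.exists_cosyzygy
    exact DomDimGE.left hses (DomDimGE.of_projective hu (hr.mono hn)) (ih (by lia) X hX)

theorem HasGorProjResolution.domDimGE (hu : IsRegularGenerator R S u) {r : ℕ}
    (hr : DomDimGE R r U) (j : ℕ) :
    ∀ (M : Type u) [AddCommGroup M] [Module R M], HasGorProjResolution R j M →
      DomDimGE R (r - j) M := by
  induction j with
  | zero => intro M _ _ hM; exact IsGorensteinProjective.domDimGE hu hr r le_rfl M hM
  | succ j ih =>
    intro M _ _ ⟨G, p, hG, hp, hK⟩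
    rcases Nat.lt_or_ge j r with hj | hj
    · have h1 := ih _ hK
      rw [show r - j = r - (j + 1) + 1 by lia] at h1
      exact h1.right (IsSES.ker_subtype hp) (hG.domDimGE hu hr _ (by lia))
    · rw [show r - (j + 1) = 0 by lia]
      exact DomDimGE.zero

theorem gorProjDim_le_iff {j : ℕ} :
    gorProjDim R X ≤ (j : ℕ∞) ↔ ∃ n ≤ j, HasGorProjResolution R n X := by
  constructor
  · intro h
    have h' : gorProjDim R X < ((j + 1 : ℕ) : ℕ∞) :=
      h.trans_lt (by exact_mod_cast Nat.lt_succ_self j)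
    obtain ⟨_, ⟨n, rfl, hn⟩, hlt⟩ := sInf_lt_iff.1 h'
    exact ⟨n, Nat.lt_succ_iff.1 (by exact_mod_cast hlt), hn⟩
  · rintro ⟨n, hn, h⟩
    have h' : gorProjDim R X ≤ (n : ℕ∞) := sInf_le ⟨n, rfl, h⟩
    exact h'.trans (by exact_mod_cast hn)

theorem gorInjDim_le_iff {j : ℕ} :
    gorInjDim R X ≤ (j : ℕ∞) ↔ ∃ n ≤ j, HasGorInjCoresolution R n X := by
  constructor
  · intro h
    have h' : gorInjDim R X < ((j + 1 : ℕ) : ℕ∞) :=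
      h.trans_lt (by exact_mod_cast Nat.lt_succ_self j)
    obtain ⟨_, ⟨n, rfl, hn⟩, hlt⟩ := sInf_lt_iff.1 h'
    exact ⟨n, Nat.lt_succ_iff.1 (by exact_mod_cast hlt), hn⟩
  · rintro ⟨n, hn, h⟩
    have h' : gorInjDim R X ≤ (n : ℕ∞) := sInf_le ⟨n, rfl, h⟩
    exact h'.trans (by exact_mod_cast hn)

/-- The homological form of the comparison of dominant and Gorenstein projective dimension. -/
theorem domDimGE_iff_gorProjDim_le [IsArtinianRing R] [IsNoetherianRing S]
    [SMulCommClass R S U] [SMulCommClass S R U] (hu : IsRegularGenerator R S u) {r : ℕ}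
    (hR : InjDimLE R U r) (hS : InjDimLE S U r) (hr : DomDimGE R r U) (hj : j ≤ r)
    [Module.Finite R X] : DomDimGE R (r - j) X ↔ gorProjDim R X ≤ (j : ℕ∞) := by
  rw [gorProjDim_le_iff]
  constructor
  · intro h
    have h1 := h.gorDimLE hR (r - j) (by lia)
    rw [Nat.sub_sub_self hj] at h1
    exact ⟨j, le_rfl, h1.hasGorProjResolution hu hS⟩
  · rintro ⟨n, hn, h⟩
    exact (h.domDimGE hu hr).mono (by lia)

end Gorenstein

/-! ### Codominant dimension and Gorenstein injective dimension -/

section GorensteinInjective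

variable {R S : Type u} [Ring R] [Ring S] {U : Type u} [AddCommGroup U]
    [Module R U] [Module S U] {u : U}
    {E : Type u} [AddCommGroup E] [Module R E] [Module S E] [SMulCommClass R S E]
    [SMulCommClass S R E]
    {X Y Z W : Type u} [AddCommGroup X] [Module R X] [AddCommGroup Y] [Module R Y]
    [AddCommGroup Z] [Module R Z] [AddCommGroup W] [Module R W]
    {f : X →ₗ[R] Y} {g : Y →ₗ[R] Z}

theorem IsSES.equiv_comp (h : IsSES f g) (e : Z ≃ₗ[R] W) : IsSES f (e.toLinearMap ∘ₗ g) where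
  inj := h.inj
  exact y := by
    rw [← h.exact y, LinearMap.comp_apply, LinearEquiv.coe_coe, map_eq_zero_iff e e.injective]
  surj := e.surjective.comp h.surj

namespace IsHalfDuality

theorem dual_ses (hE : IsHalfDuality R S E) (h : IsSES f g) :
    IsSES (homDual S E g) (homDual S E f) :=
  h.homDual S E fun φ => by
    have := hE.injective
    obtain ⟨ψ, hψ⟩ := Module.Injective.out f h.inj φ
    exact ⟨ψ, LinearMap.ext hψ⟩

/-- The isomorphism of a finitely generated module with its double dual. -/
noncomputable def evalEquiv (hE : IsHalfDuality R S E) (X : Type u) [AddCommGroup X] [Module R X]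
    [hX : Module.Finite R X] : X ≃ₗ[R] ((X →ₗ[R] E) →ₗ[S] E) :=
  LinearEquiv.ofBijective (homEval S E X) (hE.reflexive (ModuleCat.of R X) hX)

theorem evalEquiv_apply (hE : IsHalfDuality R S E) [Module.Finite R X] (x : X) :
    hE.evalEquiv X x = homEval S E X x := rfl

/-- The duality functor is full. -/
theorem exists_homDual_eq (hE : IsHalfDuality R S E) [Module.Finite R Y]
    (G : (Y →ₗ[R] E) →ₗ[S] (X →ₗ[R] E)) : ∃ ψ : X →ₗ[R] Y, homDual S E ψ = G := by
  refine ⟨(hE.evalEquiv Y).symm.toLinearMap ∘ₗ homDual R E G ∘ₗ homEval S E X, ?_⟩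
  ext χ x
  rw [homDual_apply, ← homEval_apply S E, ← hE.evalEquiv_apply]
  simp

/-- The duality functor is faithful. -/
theorem homDual_injective (hE : IsHalfDuality R S E) [Module.Finite R Y] {φ ψ : X →ₗ[R] Y}
    (h : homDual S E φ = homDual S E ψ) : φ = ψ := by
  ext x
  apply (hE.evalEquiv Y).injective
  ext χ
  exact LinearMap.congr_fun (LinearMap.congr_fun h χ) x

end IsHalfDuality

theorem IsGorensteinInjective.domDimGE_dual [IsArtinianRing R] (hu : IsRegularGenerator R S u)
    (hE : IsHalfDuality R S E) (hE' : IsHalfDuality S R E) {r : ℕ} (hr : DomDimGE S r U)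
    (hX : IsGorensteinInjective R X) : DomDimGE S r (X →ₗ[R] E) := by
  obtain ⟨I, d, hI, hd, -, ⟨e⟩⟩ := hX
  have key : ∀ n ≤ r, ∀ k : ℤ, DomDimGE S n (LinearMap.ker (d k) →ₗ[R] E) := by
    intro n
    induction n with
    | zero => intro _ k; exact DomDimGE.zero
    | succ n ih =>
      intro hn k
      obtain ⟨m, rfl⟩ : ∃ m, k = m + 1 := ⟨k - 1, by ring⟩
      have := (hI m).1
      have := (hI m).2
      have hses : IsSES (LinearMap.ker (d m)).subtype
          ((d m).codRestrict (LinearMap.ker (d (m + 1))) fun x => (hd m _).2 ⟨x, rfl⟩) := by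
        refine ⟨Submodule.injective_subtype _, fun y => ?_, ?_⟩
        · rw [Subtype.ext_iff]
          change d m y = 0 ↔ _
          exact ⟨fun h => ⟨⟨y, h⟩, rfl⟩, by rintro ⟨⟨y, h⟩, rfl⟩; exact h⟩
        · rintro ⟨y, hy⟩
          obtain ⟨x, rfl⟩ := (hd m _).1 hy
          exact ⟨x, rfl⟩
      have := hE.finite (I m) (hI m).1
      have := hu.dual_projective hE hE' (X := I m)
      exact DomDimGE.left (hE.dual_ses hses)
        (DomDimGE.of_projective hu.symm (hr.mono hn)) (ih (by lia) m)
  exact (key r le_rfl 0).congr (homDualEquiv S E e)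

theorem HasGorInjCoresolution.domDimGE_dual [IsArtinianRing R] (hu : IsRegularGenerator R S u)
    (hE : IsHalfDuality R S E) (hE' : IsHalfDuality S R E) {r : ℕ} (hr : DomDimGE S r U) (j : ℕ) :
    ∀ (M : Type u) [AddCommGroup M] [Module R M], HasGorInjCoresolution R j M →
      DomDimGE S (r - j) (M →ₗ[R] E) := by
  induction j with
  | zero => intro M _ _ hM; exact IsGorensteinInjective.domDimGE_dual hu hE hE' hr hM
  | succ j ih =>
    intro M _ _ ⟨G, ι, hG, hι, hC⟩
    rcases Nat.lt_or_ge j r with hj | hj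
    · have h1 := ih _ hC
      rw [show r - j = r - (j + 1) + 1 by lia] at h1
      exact h1.right (hE.dual_ses (IsSES.mkQ hι))
        ((hG.domDimGE_dual hu hE hE' hr).mono (by lia))
    · rw [show r - (j + 1) = 0 by lia]
      exact DomDimGE.zero

variable [SMulCommClass R S U] [SMulCommClass S R U]

theorem GorDimLE.isGorensteinInjective [IsArtinianRing R] [IsArtinianRing S]
    (hu : IsRegularGenerator R S u)
    (hE : IsHalfDuality R S E) (hE' : IsHalfDuality S R E) {r : ℕ} (hR : InjDimLE R U r)
    [Module.Finite R X] (hX : GorDimLE S U 0 (X →ₗ[R] E)) : IsGorensteinInjective R X := by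
  refine isGorensteinInjective_of_class
    (fun X => Module.Finite R X ∧ GorDimLE S U 0 (X →ₗ[R] E)) ?_ ?_ ?_ (ModuleCat.of R X)
    ⟨‹_›, hX⟩
  · rintro X ⟨h1, h2⟩
    obtain ⟨I, f, hI1, hI2, hf⟩ := hu.hasFiniteInjectiveEmbeddings hE hE' X h1
    have := hu.dual_projective hE hE' (X := I)
    exact ⟨I, ModuleCat.of R (I ⧸ LinearMap.range f), f, _, ⟨hI1, hI2⟩, IsSES.mkQ hf,
      inferInstanceAs (Module.Finite R (I ⧸ LinearMap.range f)),
      GorDimLE.left (hE.dual_ses (IsSES.mkQ hf)) (h2.mono (Nat.zero_le 1))⟩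
  · rintro X ⟨h1, h2⟩
    have := hE.finite X h1
    have := hE.injective
    obtain ⟨P, Y, f, g, hP1, hP2, hses, hY1, hY2⟩ := h2.exists_cosyzygy hu.symm hR
    exact ⟨ModuleCat.of R (P →ₗ[S] E), ModuleCat.of R (Y →ₗ[S] E), homDual R E g,
      (hE.evalEquiv X).symm.toLinearMap ∘ₗ homDual R E f,
      ⟨hE'.finite P hP1, hu.symm.dual_injective⟩, (hE'.dual_ses hses).equiv_comp _,
      hE'.finite Y hY1, hY2.congr (hE'.evalEquiv Y)⟩
  · rintro X P X' Q f g hses ⟨_, h2⟩ hP ⟨h3, _⟩ hQ1 hQ2 φ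
    have := hE.finite Q hQ1
    have := hu.dual_projective hE hE' (X := Q)
    obtain ⟨G, hG⟩ := h2.exists_extend hu.symm (hE.dual_ses hses) (homDual S E φ)
    obtain ⟨ψ, rfl⟩ := hE.exists_homDual_eq G
    exact ⟨ψ, hE.homDual_injective hG⟩

theorem GorDimLE.hasGorInjCoresolution [IsArtinianRing R] [IsArtinianRing S]
    (hu : IsRegularGenerator R S u) (hE : IsHalfDuality R S E) (hE' : IsHalfDuality S R E)
    {r : ℕ} (hR : InjDimLE R U r) (j : ℕ) :
    ∀ (M : Type u) [AddCommGroup M] [Module R M] [Module.Finite R M],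
      GorDimLE S U j (M →ₗ[R] E) → HasGorInjCoresolution R j M := by
  induction j with
  | zero => intro M _ _ _ hM; exact hM.isGorensteinInjective hu hE hE' hR
  | succ j ih =>
    intro M _ _ _ hM
    obtain ⟨I, f, h1, h2, hf⟩ := hu.hasFiniteInjectiveEmbeddings hE hE' (ModuleCat.of R M) ‹_›
    have := hu.dual_projective hE hE' (X := I)
    exact ⟨I, f, GorDimLE.isGorensteinInjective (X := I) hu hE hE' hR GorDimLE.of_projective, hf,
      ih _ (GorDimLE.left (hE.dual_ses (IsSES.mkQ hf)) hM)⟩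

/-- The homological form of the comparison of codominant and Gorenstein injective dimension. -/
theorem domDimGE_dual_iff_gorInjDim_le [IsArtinianRing R] [IsArtinianRing S]
    (hu : IsRegularGenerator R S u) (hE : IsHalfDuality R S E) (hE' : IsHalfDuality S R E)
    {r j : ℕ} (hR : InjDimLE R U r) (hS : InjDimLE S U r) (hr : DomDimGE S r U) (hj : j ≤ r)
    [Module.Finite R X] :
    DomDimGE S (r - j) (X →ₗ[R] E) ↔ gorInjDim R X ≤ (j : ℕ∞) := by
  have := hE.finite (ModuleCat.of R X) ‹_›
  rw [gorInjDim_le_iff]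
  constructor
  · intro h
    have h1 := h.gorDimLE hS (r - j) (by lia)
    rw [Nat.sub_sub_self hj] at h1
    exact ⟨j, le_rfl, h1.hasGorInjCoresolution hu hE hE' hR⟩
  · rintro ⟨n, hn, h⟩
    exact (h.domDimGE_dual hu hE hE' hr).mono (by lia)

end GorensteinInjective

/-! ### The duality of a finite-dimensional algebra -/

section FiniteDimensionalAlgebra

/-- The `K`-linear form `τ` exhibits the `R`-module `E` as the `K`-dual of `R`: every linear form on
`R` is `r ↦ τ (r • e)` for a unique `e`. -/
structure IsDualizingForm (K R : Type u) {E : Type u} [Field K] [Ring R] [Algebra K R]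
    [AddCommGroup E] [Module K E] [Module R E] (τ : E →ₗ[K] K) : Prop where
  inj : ∀ e : E, (∀ r : R, τ (r • e) = 0) → e = 0
  surj : ∀ l : R →ₗ[K] K, ∃ e : E, ∀ r : R, τ (r • e) = l r

variable {K R S E : Type u} [Field K] [Ring R] [Algebra K R] [Ring S] [Algebra K S]
  [AddCommGroup E] [Module K E] [Module R E] [IsScalarTower K R E] {τ : E →ₗ[K] K}

namespace IsDualizingForm

section

variable {X : Type u} [AddCommGroup X] [Module R X] [Module K X] [IsScalarTower K R X]

/-- `Hom_R(X, E) ≃ Hom_K(X, K)`, by composition with `τ`. -/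
noncomputable def homEquiv (h : IsDualizingForm K R τ) (X : Type u) [AddCommGroup X] [Module R X]
    [Module K X] [IsScalarTower K R X] : (X →ₗ[R] E) ≃ₗ[K] (X →ₗ[K] K) :=
  LinearEquiv.ofBijective
    { toFun := fun φ => τ ∘ₗ φ.restrictScalars K
      map_add' := fun φ ψ => by ext x; simp
      map_smul' := fun c φ => by ext x; simp }
    (by
      have hext : ∀ e e' : E, (∀ r : R, τ (r • e) = τ (r • e')) → e = e' := fun e e' he =>
        sub_eq_zero.1 (h.inj _ fun r => by rw [smul_sub, map_sub, he, sub_self])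
      constructor
      · intro φ ψ hφ
        ext x
        refine hext _ _ fun r => ?_
        rw [← map_smul, ← map_smul]
        exact LinearMap.congr_fun hφ (r • x)
      · intro l
        choose e he using fun x : X =>
          h.surj (l ∘ₗ (LinearMap.toSpanSingleton R X x).restrictScalars K)
        have he : ∀ (x : X) (r : R), τ (r • e x) = l (r • x) := he
        refine ⟨{ toFun := e, map_add' := fun x y => ?_, map_smul' := fun r x => ?_ }, ?_⟩
        · refine hext _ _ fun r => ?_
          rw [smul_add, map_add, he, he, he, smul_add, map_add]
        · refine hext _ _ fun s => ?_
          rw [he, RingHom.id_apply, smul_smul, smul_smul, he]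
        · ext x
          have := he x 1
          rwa [one_smul, one_smul] at this)

theorem homEquiv_apply (h : IsDualizingForm K R τ) (φ : X →ₗ[R] E) (x : X) :
    h.homEquiv X φ x = τ (φ x) := rfl

theorem finite_hom (h : IsDualizingForm K R τ) [Module.Finite K X] :
    Module.Finite K (X →ₗ[R] E) :=
  Module.Finite.equiv (h.homEquiv X).symm

theorem finrank_hom (h : IsDualizingForm K R τ) :
    Module.finrank K (X →ₗ[R] E) = Module.finrank K X :=
  (h.homEquiv X).finrank_eq.trans Subspace.dual_finrank_eq

end

theorem injective (h : IsDualizingForm K R τ) : Module.Injective R E where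
  out X Y _ _ _ _ i hi φ := by
    let _ : Module K X := Module.compHom X (algebraMap K R)
    let _ : Module K Y := Module.compHom Y (algebraMap K R)
    have : IsScalarTower K R X := .of_algebraMap_smul fun _ _ => rfl
    have : IsScalarTower K R Y := .of_algebraMap_smul fun _ _ => rfl
    obtain ⟨p, hp⟩ := LinearMap.exists_leftInverse_of_injective (i.restrictScalars K)
      (LinearMap.ker_eq_bot.2 hi)
    refine ⟨(h.homEquiv Y).symm (h.homEquiv X φ ∘ₗ p), ?_⟩
    suffices H : (h.homEquiv Y).symm (h.homEquiv X φ ∘ₗ p) ∘ₗ i = φ from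
      LinearMap.congr_fun H
    apply (h.homEquiv X).injective
    ext x
    rw [homEquiv_apply, LinearMap.comp_apply, ← h.homEquiv_apply, LinearEquiv.apply_symm_apply,
      LinearMap.comp_apply]
    exact congrArg _ (LinearMap.congr_fun hp x)

/-- Over a field, reflexivity of finitely generated modules follows by counting dimensions. -/
theorem isHalfDuality [FiniteDimensional K R] [Module S E] [IsScalarTower K S E]
    [SMulCommClass R S E] [SMulCommClass S R E] (h : IsDualizingForm K R τ)
    (h' : IsDualizingForm K S τ) : IsHalfDuality R S E where
  injective := h.injective
  finite X hX := by
    let _ : Module K X := Module.compHom X (algebraMap K R)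
    have : IsScalarTower K R X := .of_algebraMap_smul fun _ _ => rfl
    have : Module.Finite K X := Module.Finite.trans R X
    have := h.finite_hom (X := X)
    exact Module.Finite.of_restrictScalars_finite K S (X →ₗ[R] E)
  reflexive X hX := by
    let _ : Module K X := Module.compHom X (algebraMap K R)
    have : IsScalarTower K R X := .of_algebraMap_smul fun _ _ => rfl
    have : Module.Finite K X := Module.Finite.trans R X
    have := h.finite_hom (X := X)
    have := h'.finite_hom (X := X →ₗ[R] E)
    have hinj : Function.Injective (homEval (R := R) S E X) := by
      rw [← LinearMap.ker_eq_bot, Submodule.eq_bot_iff]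
      intro x hx
      by_contra hx0
      obtain ⟨l, hl⟩ : ∃ l : X →ₗ[K] K, l x ≠ 0 := by
        by_contra! hl
        exact hx0 ((Module.forall_dual_apply_eq_zero_iff K x).1 hl)
      refine hl ?_
      have h1 := h.homEquiv_apply ((h.homEquiv X).symm l) x
      rw [LinearEquiv.apply_symm_apply] at h1
      rw [h1, ← homEval_apply S E, LinearMap.mem_ker.1 hx]
      simp
    refine ⟨hinj, ?_⟩
    have hdim : Module.finrank K X = Module.finrank K ((X →ₗ[R] E) →ₗ[S] E) :=
      (h'.finrank_hom.trans h.finrank_hom).symm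
    exact (LinearMap.injective_iff_surjective_of_finrank_eq_finrank
      (f := (homEval (R := R) S E X).restrictScalars K) hdim).1 hinj

end IsDualizingForm

/-- The `K`-dual of the algebra `A` as a bimodule: `(a • f) x = f (x * a)` and
`(op a • f) x = f (a * x)`. -/
def AlgebraDual (K A : Type u) [Field K] [Ring A] [Algebra K A] : Type u := A →ₗ[K] K

namespace AlgebraDual

variable (K A : Type u) [Field K] [Ring A] [Algebra K A]

instance : AddCommGroup (AlgebraDual K A) := inferInstanceAs (AddCommGroup (A →ₗ[K] K))

instance : Module K (AlgebraDual K A) := inferInstanceAs (Module K (A →ₗ[K] K))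

instance : FunLike (AlgebraDual K A) A K := inferInstanceAs (FunLike (A →ₗ[K] K) A K)

variable {K A} in
theorem ext {f g : AlgebraDual K A} (h : ∀ x, f x = g x) : f = g := DFunLike.ext _ _ h

instance : Module A (AlgebraDual K A) where
  smul a f := LinearMap.comp (show A →ₗ[K] K from f) (LinearMap.mulRight K a)
  one_smul f := ext fun x => congrArg f (mul_one x)
  mul_smul a b f := ext fun x => congrArg f (mul_assoc x a b).symm
  smul_zero _ := rfl
  smul_add _ _ _ := rfl
  add_smul a b f := ext fun x =>
    (congrArg f (mul_add x a b)).trans (map_add (show A →ₗ[K] K from f) _ _)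
  zero_smul f := ext fun x => (congrArg f (mul_zero x)).trans (map_zero (show A →ₗ[K] K from f))

instance : Module Aᵐᵒᵖ (AlgebraDual K A) where
  smul a f := LinearMap.comp (show A →ₗ[K] K from f) (LinearMap.mulLeft K a.unop)
  one_smul f := ext fun x => congrArg f (one_mul x)
  mul_smul a b f := ext fun x => congrArg f (mul_assoc b.unop a.unop x)
  smul_zero _ := rfl
  smul_add _ _ _ := rfl
  add_smul a b f := ext fun x =>
    (congrArg f (add_mul a.unop b.unop x)).trans (map_add (show A →ₗ[K] K from f) _ _)
  zero_smul f := ext fun x => (congrArg f (zero_mul x)).trans (map_zero (show A →ₗ[K] K from f))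

variable {K A}

theorem smul_apply (a : A) (f : AlgebraDual K A) (x : A) : (a • f) x = f (x * a) := rfl

theorem op_smul_apply (a : Aᵐᵒᵖ) (f : AlgebraDual K A) (x : A) : (a • f) x = f (a.unop * x) := rfl

theorem base_smul_apply (c : K) (f : AlgebraDual K A) (x : A) : (c • f) x = c * f x := rfl

instance : SMulCommClass A Aᵐᵒᵖ (AlgebraDual K A) where
  smul_comm a b f := ext fun x => congrArg f (mul_assoc b.unop x a).symm

instance : SMulCommClass Aᵐᵒᵖ A (AlgebraDual K A) := SMulCommClass.symm _ _ _

instance : IsScalarTower K A (AlgebraDual K A) :=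
  .of_algebraMap_smul fun c f => ext fun x => by
    rw [smul_apply, base_smul_apply, ← Algebra.commutes, ← Algebra.smul_def]
    exact map_smul (show A →ₗ[K] K from f) c x

instance : IsScalarTower K Aᵐᵒᵖ (AlgebraDual K A) :=
  .of_algebraMap_smul fun c f => ext fun x => by
    rw [op_smul_apply, base_smul_apply, MulOpposite.algebraMap_apply, MulOpposite.unop_op,
      ← Algebra.smul_def]
    exact map_smul (show A →ₗ[K] K from f) c x

variable (K A)

/-- Evaluation at `1`. -/
def evalOne : AlgebraDual K A →ₗ[K] K where
  toFun f := f 1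
  map_add' _ _ := rfl
  map_smul' _ _ := rfl

theorem evalOne_smul (a : A) (f : AlgebraDual K A) : evalOne K A (a • f) = f a :=
  congrArg f (one_mul a)

theorem evalOne_op_smul (a : Aᵐᵒᵖ) (f : AlgebraDual K A) : evalOne K A (a • f) = f a.unop :=
  congrArg f (mul_one a.unop)

theorem isDualizingForm_left : IsDualizingForm K A (evalOne K A) where
  inj f h := ext fun a => (evalOne_smul K A a f).symm.trans (h a)
  surj l := ⟨l, fun a => evalOne_smul K A a l⟩

theorem isDualizingForm_right : IsDualizingForm K Aᵐᵒᵖ (evalOne K A) where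
  inj f h := ext fun a => (evalOne_op_smul K A (MulOpposite.op a) f).symm.trans (h _)
  surj l := ⟨(l ∘ₗ (MulOpposite.opLinearEquiv K).toLinearMap : A →ₗ[K] K),
    fun a => evalOne_op_smul K A a _⟩

/-- The `K`-dual of a right `A`-module `M` is `Hom_A(M, D A)`. -/
noncomputable def rightDualEquiv (M : Type u) [AddCommGroup M] [Module K M] [Module Aᵐᵒᵖ M]
    [IsScalarTower K Aᵐᵒᵖ M] : (M →ₗ[Aᵐᵒᵖ] AlgebraDual K A) ≃ₗ[A] RightDual K M :=
  let e := (isDualizingForm_right K A).homEquiv M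
  { toFun := fun φ => e φ
    invFun := fun f => e.symm f
    left_inv := fun φ => e.symm_apply_apply φ
    right_inv := fun f => e.apply_symm_apply f
    map_add' := fun φ ψ => map_add e φ ψ
    map_smul' := fun a φ => LinearMap.ext fun m => by
      change evalOne K A (a • φ m) = evalOne K A (φ (MulOpposite.op a • m))
      rw [evalOne_smul, map_smul, evalOne_op_smul, MulOpposite.unop_op] }

end AlgebraDual

theorem isRegularGenerator_one (A : Type u) [Ring A] :
    IsRegularGenerator Aᵐᵒᵖ A (1 : A) where
  left := by
    have : (fun r : Aᵐᵒᵖ => r • (1 : A)) = MulOpposite.unop := by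
      ext r; simp [MulOpposite.smul_eq_mul_unop]
    rw [this]
    exact MulOpposite.unop_bijective
  right := by
    have : (fun r : A => r • (1 : A)) = id := by
      ext r; simp
    rw [this]
    exact Function.bijective_id

end FiniteDimensionalAlgebra

theorem mainTheorem2 (K : Type u) [Field K] (A : Type u) [Ring A] [Algebra K A]
    [FiniteDimensional K A] (r : ℕ) (hA : IsAuslanderGorensteinOfDim A r)
    (j : ℕ) (hj : j ≤ r)
    (M : Type u) [AddCommGroup M] [Module K M] [Module Aᵐᵒᵖ M] [IsScalarTower K Aᵐᵒᵖ M]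
    [FiniteDimensional K M] :
    (((r - j : ℕ) : ℕ∞) ≤ domDim Aᵐᵒᵖ M ↔ gorProjDim Aᵐᵒᵖ M ≤ (j : ℕ∞)) ∧
    (((r - j : ℕ) : ℕ∞) ≤ codomDim K A M ↔ gorInjDim Aᵐᵒᵖ M ≤ (j : ℕ∞)) := by
  obtain ⟨⟨hl, hr⟩, hd, -⟩ := hA
  have : FiniteDimensional K Aᵐᵒᵖ := Module.Finite.equiv (MulOpposite.opLinearEquiv K)
  have : IsArtinianRing A := IsArtinianRing.of_finite K A
  have : IsArtinianRing Aᵐᵒᵖ := IsArtinianRing.of_finite K Aᵐᵒᵖ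
  have : Module.Finite Aᵐᵒᵖ M := Module.Finite.of_restrictScalars_finite K Aᵐᵒᵖ M
  have hu := isRegularGenerator_one A
  have hE : IsHalfDuality Aᵐᵒᵖ A (AlgebraDual K A) :=
    (AlgebraDual.isDualizingForm_right K A).isHalfDuality (AlgebraDual.isDualizingForm_left K A)
  have hE' : IsHalfDuality A Aᵐᵒᵖ (AlgebraDual K A) :=
    (AlgebraDual.isDualizingForm_left K A).isHalfDuality (AlgebraDual.isDualizingForm_right K A)
  have hR : InjDimLE Aᵐᵒᵖ A r := fun _ _ hi => ExtVanish.of_injectiveDimension_eq hr hi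
  have hS : InjDimLE A A r := fun _ _ hi => ExtVanish.of_injectiveDimension_eq hl hi
  have := hu.finite
  have hdom : DomDimGE Aᵐᵒᵖ r A := DomDimGE.of_le_domDim hd.ge
  have hdom' : DomDimGE A r A := hu.domDimGE_symm hE hE' hdom
  constructor
  · rw [le_domDim_iff (hu.hasFiniteInjectiveEmbeddings hE hE'),
      domDimGE_iff_gorProjDim_le hu hR hS hdom hj]
  · let e := AlgebraDual.rightDualEquiv K A M
    have := hE.finite (ModuleCat.of Aᵐᵒᵖ M) ‹_›
    have : Module.Finite A (RightDual K M) := Module.Finite.equiv e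
    rw [codomDim, le_domDim_iff (hu.symm.hasFiniteInjectiveEmbeddings hE' hE),
      ← domDimGE_dual_iff_gorInjDim_le hu hE hE' hR hS hdom' hj]
    exact ⟨fun h => h.congr e.symm, fun h => h.congr e⟩
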